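/- **Setting.** Let $\overline{\mathbb C}$ be the Riemann sphere and $B(p,r)$ the open disk of centre $p$ and radius $r$ in the spherical metric. A *surface spread over the sphere* is a pair $(S,f)$ of a connected topological surface $S$ without boundary (Hausdorff, second countable; it may be compact) and a continuous, open and discrete map $f\colon S\to\overline{\mathbb C}$. Near each point $x\in S$ the map $f$ is, in suitable topological coordinates centred at $x$ and $f(x)$, the map $z\mapsto z^d$ of the unit disk, for a unique integer $d\ge 1$; $x$ is *critical*, and $f(x)$ is a *critical value*, if $d>1$. A point $a\in\overline{\mathbb C}$ is an *asymptotic value* if there is a path $\gamma\colon[0,1)\to S$ that leaves every compact subset of $S$ as $t\to1$ and satisfies $\lim_{t\to 1}f(\gamma(t))=a$. Critical and asymptotic values are called *singular values*, and $(S,f)$ belongs to the *Speiser class* if $f$ has only finitely many of them. A *pointed surface* is a triple $(S,f,w)$ with $(S,f)$ as above and $w\in S$ not critical. Write $(S_1,f_1,w_1)\subset(S_2,f_2,w_2)$ if there is a continuous injective map $\phi\colon S_1\to S_2$ with $\phi(w_1)=w_2$ and $f_1=f_2\circ\phi$, and call the two triples *equivalent* if $\phi$ can be chosen to be a homeomorphism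 of $S_1$ onto $S_2$. Let $(S_n,f_n,w_n)$, $n\in\mathbb N$, be a sequence of pointed surfaces for which there are $p\in\overline{\mathbb C}$ and $r>0$ such that, for every $n$, $f_n(w_n)=p$ and $f_n$ maps some domain $W_n\subset S_n$ containing $w_n$ homeomorphically onto $B(p,r)$. A *kernel* of the sequence is a pointed surface $(S,f,w)$ such that 1. there is a set $E\subset S\setminus\{w\}$ without accumulation points in $S$ such that for every compact $K\subset S\setminus E$ with $w\in K$ there is $N\in\mathbb N$ such that for each $n>N$ there is a topological embedding $\phi_{K,n}\colon K\to S_n$ with $\phi_{K,n}(w)=w_n$ and $f_n\circ\phi_{K,n}=f$ on $K$; 2. $(S,f,w)$ is maximal among the pointed surfaces with property 1: if $(S',f',w')$ has property 1 and $(S,f,w)\subset(S',f',w')$, then the two are equivalent. **Proposition 2.2.** If some kernel $(S,f,w)$ of $(S_n,f_n,w_n)$, $n\in\mathbb N$, is such that $(S,f)$ belongs to the Speiser class, then the kernel of the sequence is unique: any two kernels of $(S_n,f_n,w_n)$, $n\in\mathbb N$, are equivalent. -/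

import Mathlib

open Set Filter Topology

universe u

noncomputable section

/-- The Riemann sphere. -/
abbrev RSphere : Type := OnePoint ℂ

/-- The chordal distance on the Riemann sphere: the Euclidean distance in `ℝ³` of the points of
the unit sphere that correspond to `a` and `b` under stereographic projection. -/
def chordalDist : RSphere → RSphere → ℝ
  | none, none => 0
  | none, some z => 2 / √(1 + ‖z‖ ^ 2)
  | some z, none => 2 / √(1 + ‖z‖ ^ 2)
  | some z, some z' => 2 * ‖z - z'‖ / (√(1 + ‖z‖ ^ 2) * √(1 + ‖z'‖ ^ 2))

/-- The spherical distance, i.e. the path distance of the metric `2|dz| / (1 + |z|²)`. -/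
def sphericalDist (a b : RSphere) : ℝ := 2 * Real.arcsin (chordalDist a b / 2)

/-- The open disk `B(p, r)` in the spherical metric. -/
def sphericalBall (p : RSphere) (r : ℝ) : Set RSphere := {q | sphericalDist q p < r}

/-- The map `f` has local degree `d ≥ 1` at `x`: in suitable topological coordinates `h₁` on an
open neighbourhood `U` of `x` and `h₂` on `f(U)`, both with values in the unit disk and centred at
`x` and `f x`, it is `z ↦ z ^ d`. -/
def HasLocalDegree {S : Type u} [TopologicalSpace S] (f : S → RSphere) (x : S) (d : ℕ) : Prop :=
  1 ≤ d ∧ ∃ (U : Set S) (hx : x ∈ U), IsOpen U ∧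
    ∃ (h₁ : U ≃ₜ Metric.ball (0 : ℂ) 1) (h₂ : (f '' U) ≃ₜ Metric.ball (0 : ℂ) 1),
      (h₁ ⟨x, hx⟩ : ℂ) = 0 ∧ (h₂ ⟨f x, mem_image_of_mem f hx⟩ : ℂ) = 0 ∧
      ∀ y : U, (h₂ ⟨f y, mem_image_of_mem f y.2⟩ : ℂ) = (h₁ y : ℂ) ^ d

/-- A critical point of a continuous, open and discrete map `f` from a surface to the sphere: a
point at which the local degree is greater than `1`. Since `f` has exactly one local degree
`d ≥ 1` at each point, this says that its local degree is not `1`. -/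
def IsCriticalPoint {S : Type u} [TopologicalSpace S] (f : S → RSphere) (x : S) : Prop :=
  ¬ HasLocalDegree f x 1

def IsCriticalValue {S : Type u} [TopologicalSpace S] (f : S → RSphere) (a : RSphere) : Prop :=
  ∃ x : S, IsCriticalPoint f x ∧ f x = a

/-- An asymptotic value of `f`: the limit of `f` along a path `γ : [0, 1) → S` that leaves every
compact subset of `S`. Only the values of `γ` on `[0, 1)` matter. -/
def IsAsymptoticValue {S : Type u} [TopologicalSpace S] (f : S → RSphere) (a : RSphere) : Prop :=
  ∃ γ : ℝ → S, ContinuousOn γ (Ico 0 1) ∧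
    (∀ K : Set S, IsCompact K → ∀ᶠ t in 𝓝[<] (1 : ℝ), γ t ∉ K) ∧
    Tendsto (fun t => f (γ t)) (𝓝[<] (1 : ℝ)) (𝓝 a)

def IsSingularValue {S : Type u} [TopologicalSpace S] (f : S → RSphere) (a : RSphere) : Prop :=
  IsCriticalValue f a ∨ IsAsymptoticValue f a

/-- A surface spread over the sphere: a connected topological surface `carrier` (Hausdorff, second
countable, locally homeomorphic to the plane, without boundary, compact or not) together with a
continuous, open and discrete map `proj` to the Riemann sphere. -/
structure SpreadSurface where
  carrier : Type u
  [top : TopologicalSpace carrier]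
  [t2 : T2Space carrier]
  [secondCountable : SecondCountableTopology carrier]
  [connected : ConnectedSpace carrier]
  chart_at : ∀ x : carrier, ∃ e : OpenPartialHomeomorph carrier ℂ, x ∈ e.source
  proj : carrier → RSphere
  continuous_proj : Continuous proj
  isOpenMap_proj : IsOpenMap proj
  discrete_proj : ∀ a : RSphere, IsDiscrete (proj ⁻¹' {a})

attribute [instance] SpreadSurface.top SpreadSurface.t2 SpreadSurface.secondCountable
  SpreadSurface.connected

/-- The Speiser class: the projection has only finitely many singular values. -/
def SpreadSurface.IsSpeiser (X : SpreadSurface.{u}) : Prop :=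
  {a : RSphere | IsSingularValue X.proj a}.Finite

/-- A pointed surface spread over the sphere: the marked point `pt` is not critical. -/
structure PointedSurface extends SpreadSurface.{u} where
  pt : carrier
  not_critical : ¬ IsCriticalPoint proj pt

namespace PointedSurface

/-- Equivalence of pointed surfaces spread over the sphere. -/
def Equivalent (X Y : PointedSurface.{u}) : Prop :=
  ∃ h : X.carrier ≃ₜ Y.carrier, h X.pt = Y.pt ∧ ∀ x, X.proj x = Y.proj (h x)

/-- The order relation `X ⊂ Y` on pointed surfaces spread over the sphere. -/
def Sub (X Y : PointedSurface.{u}) : Prop :=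
  ∃ φ : X.carrier → Y.carrier, Continuous φ ∧ Function.Injective φ ∧
    φ X.pt = Y.pt ∧ ∀ x, X.proj x = Y.proj (φ x)

end PointedSurface

/-- The standing assumption on sequences: all marked points lie over one point `p`, and one disk
`B(p, r)` lifts homeomorphically to a domain around the marked point in every surface. -/
def HasCommonDisk (T : ℕ → PointedSurface.{u}) : Prop :=
  ∃ (p : RSphere) (r : ℝ), 0 < r ∧ ∀ n, (T n).proj (T n).pt = p ∧
    ∃ W : Set (T n).carrier, IsOpen W ∧ IsConnected W ∧ (T n).pt ∈ W ∧
      ∃ e : W ≃ₜ sphericalBall p r, ∀ x : W, (e x : RSphere) = (T n).proj x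

/-- There is a discrete set `E` (without accumulation points in the surface `X`) that does not
contain the marked point, such that every compact set in its complement that contains the marked
point embeds into the surfaces `T n` for all large `n`, respecting projections and marked
points. -/
def CompactsEmbed (T : ℕ → PointedSurface.{u}) (X : PointedSurface.{u}) : Prop :=
  ∃ E : Set X.carrier, IsClosed E ∧ IsDiscrete E ∧ X.pt ∉ E ∧
    ∀ (K : Set X.carrier), IsCompact K → K ⊆ Eᶜ → ∀ hK : X.pt ∈ K,
      ∃ N : ℕ, ∀ n > N, ∃ φ : K → (T n).carrier, IsEmbedding φ ∧
        φ ⟨X.pt, hK⟩ = (T n).pt ∧ ∀ x : K, (T n).proj (φ x) = X.proj x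

/-- `X` is a kernel of the sequence `T`: its compact subsets embed as described above, and it is
maximal among the pointed surfaces with this property. -/
def IsKernel (T : ℕ → PointedSurface.{u}) (X : PointedSurface.{u}) : Prop :=
  CompactsEmbed T X ∧ ∀ Y : PointedSurface.{u}, CompactsEmbed T Y → X.Sub Y → X.Equivalent Y

end

/-!
Let `X` be a kernel of the Speiser class, with finite set `Q` of singular values. The theorem
follows from the claim that *every* pointed surface `Y` whose compact subsets embed into the
sequence satisfies `Y ⊂ X` (`IsKernel.sub_of_compactsEmbed`): if `Y` is itself a kernel, then its
maximality gives `Y ≅ X`.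

A diagonal choice turns the given embeddings of compact sets into sequences of maps
`φ n : X → T n` and `ψ n : Y → T n` (`IsLimitMap`). Call `x` and `y` matched if
`φ n x = ψ n y` for all large `n`. Off `Q` paths can be lifted to `X`, since the end of a maximal
lift would produce an asymptotic value, so a small disk `D` disjoint from `Q` has a section into `X`
through each point above it (`SpreadSurface.exists_regular_nhds`). Two lifts of `D` to `T n` that
meet at one point coincide. Hence the set of points of `Y`, off its exceptional set and the fibres
over `Q`, that are matched with points of `X` is open and closed (`exists_localMatch`); it is not
empty because the common disk makes the marked points match. Injectivity of the `φ n` and the `ψ n`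
makes matching a continuous injective map `g` into `X`, defined on `Y` off a closed discrete
set (`exists_matching`). Here it is essential that `X` is of the Speiser class: for a
general `X` the lifts would not exist.

The closure `Γ` of the graph of `g` is the graph of a homeomorphism between open subsets of `X` and
`Y` (`isGluing_closureGraph`), so `X` and `Y` can be glued along `Γ`. As `Γ` is closed, the glued
surface is Hausdorff. Moreover `φ n x = ψ n y` holds for large `n`, locally uniformly,
exactly if `(x, y) ∈ Γ` (`eventually_meet_iff`), so that the compact subsets of the glued surface
again embed into the sequence (`IsGluing.compactsEmbed_glue`). By maximality of `X` the glued
surface, which contains `X` and `Y`, is equivalent to `X`.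

The topological input is invariance of domain for surfaces (`LocallyPlanar.isOpen_image`). In the
plane it is proved by Borsuk's argument: a nonvanishing continuous function on the plane has a
continuous logarithm, so it cannot be odd on a circle (`not_odd_on_sphere`).
-/

noncomputable section

/-! ### Invariance of domain in the plane -/

theorem exists_clog {v : ℂ → ℂ} (hv : Continuous v) (h0 : ∀ z, v z ≠ 0) :
    ∃ L : ℂ → ℂ, Continuous L ∧ ∀ z, Complex.exp (L z) = v z := by
  obtain ⟨L, ⟨-, hL⟩, -⟩ := Complex.isCoveringMapOn_exp.existsUnique_continuousMap_lifts
    ⟨v, hv⟩ (a₀ := 0) (Complex.exp_log (h0 0)) h0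
  exact ⟨L, L.continuous, fun z => congrFun hL z⟩

/-- A continuous nonvanishing function on the plane is not odd on a circle: the imaginary part
of `log v(z) - log v(-z)` would be odd, hence vanish somewhere, where `v(z) / v(-z) > 0`. -/
theorem not_odd_on_sphere {v : ℂ → ℂ} (hv : Continuous v) (h0 : ∀ z, v z ≠ 0) {R : ℝ}
    (hR : 0 < R) (hodd : ∀ z ∈ Metric.sphere (0 : ℂ) R, v (-z) = -v z) : False := by
  obtain ⟨L, hL, hexp⟩ := exists_clog hv h0
  have hconn : IsPreconnected (Metric.sphere (0 : ℂ) R) :=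
    isPreconnected_sphere (by simp [Complex.rank_real_complex]) 0 R
  set d : ℂ → ℝ := fun z => (L z - L (-z)).im with hd
  have hdc : Continuous d := by fun_prop
  have hdodd : ∀ z, d (-z) = -d z := by
    intro z
    simp [hd]
  have hRm : (R : ℂ) ∈ Metric.sphere (0 : ℂ) R := by simp [abs_of_pos hR]
  have hRm' : -(R : ℂ) ∈ Metric.sphere (0 : ℂ) R := by simp [abs_of_pos hR]
  have hz : ∃ z ∈ Metric.sphere (0 : ℂ) R, d z = 0 := by
    rcases le_total (d R) 0 with h | h
    · exact hconn.intermediate_value hRm hRm' hdc.continuousOn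
        ⟨h, by rw [hdodd]; linarith⟩
    · exact hconn.intermediate_value hRm' hRm hdc.continuousOn
        ⟨by rw [hdodd]; linarith, h⟩
  obtain ⟨z, hzS, hz⟩ := hz
  have h1 : Complex.exp (L z - L (-z)) = -1 := by
    rw [Complex.exp_sub, hexp, hexp, hodd z hzS, div_neg, div_self (h0 z)]
  have h2 : L z - L (-z) = ((L z - L (-z)).re : ℂ) := by
    apply Complex.ext
    · simp
    · simpa [hd] using hz
  rw [h2, ← Complex.ofReal_exp] at h1
  have h3 : Real.exp (L z - L (-z)).re = -1 := by exact_mod_cast h1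
  linarith [Real.exp_pos (L z - L (-z)).re]

/-- If the image missed a point `c` close to `h 0`, the nonvanishing function `h - c` on the unit
disk could be deformed along a collar, through `h - h 0`, into the odd function `h(z) - h(-z)` on
the boundary circle. -/
theorem image_unit_closedBall_mem_nhds {h : ℂ → ℂ}
    (hc : ContinuousOn h (Metric.closedBall 0 1)) (hi : InjOn h (Metric.closedBall 0 1)) :
    h '' Metric.closedBall 0 1 ∈ 𝓝 (h 0) := by
  by_contra hne
  have hcpt : IsCompact (h '' Metric.sphere 0 1) :=
    (isCompact_sphere (0 : ℂ) 1).image_of_continuousOn (hc.mono Metric.sphere_subset_closedBall)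
  have h0 : h 0 ∉ h '' Metric.sphere 0 1 := by
    rintro ⟨z, hz, hz'⟩
    have := hi (Metric.sphere_subset_closedBall hz) (by simp) hz'
    simp [this] at hz
  obtain ⟨δ, hδ, hball⟩ := Metric.isOpen_iff.1 hcpt.isClosed.isOpen_compl _ h0
  obtain ⟨c, hcb, hcn⟩ : ∃ c ∈ Metric.ball (h 0) δ, c ∉ h '' Metric.closedBall 0 1 := by
    by_contra! hcon
    exact hne (mem_of_superset (Metric.ball_mem_nhds _ hδ) hcon)
  set π : ℂ → ℂ := fun z => (max 1 ‖z‖)⁻¹ • z with hπ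
  set s : ℂ → ℝ := fun z => max 0 (min 1 (‖z‖ - 2)) with hs
  set t : ℂ → ℝ := fun z => max 0 (min 1 (2 - ‖z‖)) with ht
  have hpos : ∀ z : ℂ, 0 < max 1 ‖z‖ := fun z => lt_max_of_lt_left one_pos
  have hπc : Continuous π := by
    refine Continuous.smul (Continuous.inv₀ (by fun_prop) fun z => (hpos z).ne') continuous_id
  have hπn : ∀ z, ‖π z‖ ≤ 1 := by
    intro z
    rw [hπ, norm_smul, norm_inv, Real.norm_of_nonneg (hpos z).le, inv_mul_le_iff₀ (hpos z), mul_one]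
    exact le_max_right _ _
  have hsc : Continuous s := by fun_prop
  have htc : Continuous t := by fun_prop
  have hs0 : ∀ z, 0 ≤ s z := fun z => le_max_left _ _
  have hs1 : ∀ z, s z ≤ 1 := fun z => max_le zero_le_one (min_le_left _ _)
  have hsπ : ∀ z, ‖-(s z • π z)‖ ≤ 1 := by
    intro z
    rw [norm_neg, norm_smul, Real.norm_of_nonneg (hs0 z)]
    exact mul_le_one₀ (hs1 z) (norm_nonneg _) (hπn z)
  -- `v` runs from `h - c` on the unit disk through `h - h 0` to `h(z) - h(-z)` on `|z| ≥ 3`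
  set v : ℂ → ℂ := fun z => h (π z) - (h (-(s z • π z)) + t z • (c - h 0)) with hv
  have hvc : Continuous v := by
    refine Continuous.sub (hc.comp_continuous hπc fun z => by simpa using hπn z) (Continuous.add
      (hc.comp_continuous (hsc.smul hπc).neg fun z => ?_) (htc.smul continuous_const))
    rw [mem_closedBall_zero_iff]
    exact hsπ z
  have hsphere : ∀ z : ℂ, 1 ≤ ‖z‖ → ‖π z‖ = 1 := by
    intro z hz
    rw [hπ]
    simp only [max_eq_right hz]
    rw [norm_smul, norm_inv, norm_norm, inv_mul_cancel₀ (by linarith)]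
  refine not_odd_on_sphere hvc (fun z hz => ?_) (R := 3) (by norm_num) (fun z hz => ?_)
  · rcases le_total ‖z‖ 1 with h1 | h1
    · have e1 : s z = 0 := by
        simp only [hs]; rw [max_eq_left]; exact (min_le_right _ _).trans (by linarith)
      have e2 : t z = 1 := by
        simp only [ht]; rw [min_eq_left (by linarith), max_eq_right zero_le_one]
      have e3 : π z = z := by simp [hπ, max_eq_left h1]
      simp only [hv, e1, e2, e3, zero_smul, neg_zero, one_smul, add_sub_cancel] at hz
      exact hcn ⟨z, by simpa using h1, sub_eq_zero.1 hz⟩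
    · rcases le_total ‖z‖ 2 with h2 | h2
      · have e1 : s z = 0 := by
          simp only [hs]; rw [max_eq_left]; exact (min_le_right _ _).trans (by linarith)
        have e2 : ‖t z • (c - h 0)‖ < δ := by
          have e3 : t z ≤ 1 := max_le zero_le_one (min_le_left _ _)
          have e4 : 0 ≤ t z := le_max_left _ _
          rw [norm_smul, Real.norm_of_nonneg e4]
          rw [Metric.mem_ball, dist_eq_norm] at hcb
          nlinarith [norm_nonneg (c - h 0)]
        simp only [hv, e1, zero_smul, neg_zero] at hz
        have e5 : h (π z) ∈ Metric.ball (h 0) δ := by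
          rw [Metric.mem_ball, dist_eq_norm]
          have : h (π z) - h 0 = t z • (c - h 0) := by linear_combination hz
          rwa [this]
        exact hball e5 ⟨π z, by simpa using hsphere z h1, rfl⟩
      · have e1 : t z = 0 := by
          simp only [ht]; rw [max_eq_left]; exact (min_le_right _ _).trans (by linarith)
        simp only [hv, e1, zero_smul, add_zero] at hz
        have e2 := hi (by simpa using hπn z) (by rw [mem_closedBall_zero_iff]; exact hsπ z)
          (sub_eq_zero.1 hz)
        have e3 : (1 + s z) • π z = 0 := by
          rw [add_smul, one_smul]
          nth_rewrite 1 [e2]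
          simp
        rcases smul_eq_zero.1 e3 with e4 | e4
        · linarith [hs0 z]
        · have := hsphere z h1
          simp [e4] at this
  · rw [mem_sphere_zero_iff_norm] at hz
    have e1 : ∀ w : ℂ, ‖w‖ = 3 → t w = 0 := by
      intro w hw
      simp only [ht, hw]; norm_num
    have e2 : ∀ w : ℂ, ‖w‖ = 3 → s w = 1 := by
      intro w hw
      simp only [hs, hw]; norm_num
    have e3 : π (-z) = -π z := by simp [hπ]
    simp only [hv, e1 z hz, e1 (-z) (by simpa using hz), e2 z hz, e2 (-z) (by simpa using hz), e3,
      one_smul, zero_smul, add_zero, neg_neg]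
    ring

theorem image_closedBall_mem_nhds {h : ℂ → ℂ} {a : ℂ} {r : ℝ} (hr : 0 < r)
    (hc : ContinuousOn h (Metric.closedBall a r)) (hi : InjOn h (Metric.closedBall a r)) :
    h '' Metric.closedBall a r ∈ 𝓝 (h a) := by
  set g : ℂ → ℂ := fun z => a + r • z with hg
  have hgm : MapsTo g (Metric.closedBall 0 1) (Metric.closedBall a r) := by
    intro z hz
    rw [mem_closedBall_zero_iff] at hz
    simp only [hg, Metric.mem_closedBall, dist_self_add_left, norm_smul, Real.norm_of_nonneg hr.le]
    nlinarith
  have hgc : Continuous g := by fun_prop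
  have hgi : InjOn g (Metric.closedBall 0 1) := by
    intro z _ w _ hzw
    simpa [hg, hr.ne'] using hzw
  have := image_unit_closedBall_mem_nhds (hc.comp hgc.continuousOn hgm) (hi.comp hgi hgm)
  rw [image_comp] at this
  have h0 : (h ∘ g) 0 = h a := by simp [hg]
  rw [h0] at this
  exact mem_of_superset this (image_mono hgm.image_subset)

/-! ### Topological surfaces -/

/-- Every point of `S` has an open neighbourhood homeomorphic to an open subset of the plane. -/
def LocallyPlanar (S : Type*) [TopologicalSpace S] : Prop :=
  ∀ x : S, ∃ e : OpenPartialHomeomorph S ℂ, x ∈ e.source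

namespace LocallyPlanar

variable {S S' : Type*} [TopologicalSpace S] [TopologicalSpace S']

/-- The atlas formed by one chart around each point. -/
@[reducible] def chartedSpace (hS : LocallyPlanar S) : ChartedSpace ℂ S where
  atlas := range fun x => (hS x).choose
  chartAt x := (hS x).choose
  mem_chart_source x := (hS x).choose_spec
  chart_mem_atlas x := mem_range_self x

theorem locallyCompactSpace (hS : LocallyPlanar S) : LocallyCompactSpace S :=
  letI := hS.chartedSpace
  ChartedSpace.locallyCompactSpace ℂ S

/-- Invariance of domain for surfaces. -/
theorem image_mem_nhds (hS : LocallyPlanar S) (hS' : LocallyPlanar S') {φ : S → S'} {M : Set S}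
    {x : S} (hM : M ∈ 𝓝 x) (hc : ContinuousOn φ M) (hi : InjOn φ M) : φ '' M ∈ 𝓝 (φ x) := by
  obtain ⟨e, he⟩ := hS x
  obtain ⟨e', he'⟩ := hS' (φ x)
  have h1 : M ∩ φ ⁻¹' e'.source ∈ 𝓝 x :=
    inter_mem hM ((hc.continuousAt hM).preimage_mem_nhds (e'.open_source.mem_nhds he'))
  have h2 : e.symm ⁻¹' (M ∩ φ ⁻¹' e'.source) ∩ e.target ∈ 𝓝 (e x) := by
    refine inter_mem ((e.continuousAt_symm (e.map_source he)).preimage_mem_nhds ?_)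
      (e.open_target.mem_nhds (e.map_source he))
    rwa [e.left_inv he]
  obtain ⟨r, hr, hball⟩ := Metric.nhds_basis_closedBall.mem_iff.1 h2
  set h : ℂ → ℂ := fun z => e' (φ (e.symm z)) with hh
  have hcont : ContinuousOn h (Metric.closedBall (e x) r) := by
    refine e'.continuousOn.comp (hc.comp (e.continuousOn_symm.mono fun z hz => (hball hz).2)
      fun z hz => (hball hz).1.1) fun z hz => (hball hz).1.2
  have hinj : InjOn h (Metric.closedBall (e x) r) := by
    intro z hz w hw hzw
    have h3 := e'.injOn (hball hz).1.2 (hball hw).1.2 hzw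
    exact e.symm.injOn (hball hz).2 (hball hw).2 (hi (hball hz).1.1 (hball hw).1.1 h3)
  have h4 := image_closedBall_mem_nhds hr hcont hinj
  have h5 : h (e x) = e' (φ x) := by simp [hh, e.left_inv he]
  rw [h5] at h4
  have h6 := (e'.continuousAt he').preimage_mem_nhds h4
  filter_upwards [h6, e'.open_source.mem_nhds he'] with y hy hys
  obtain ⟨z, hz, hzy⟩ := hy
  exact ⟨e.symm z, (hball hz).1.1, e'.injOn (hball hz).1.2 hys hzy⟩

theorem isOpen_image (hS : LocallyPlanar S) (hS' : LocallyPlanar S') {φ : S → S'} {M : Set S}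
    (hM : IsOpen M) (hc : ContinuousOn φ M) (hi : InjOn φ M) : IsOpen (φ '' M) := by
  rw [isOpen_iff_mem_nhds]
  rintro _ ⟨x, hx, rfl⟩
  exact hS.image_mem_nhds hS' (hM.mem_nhds hx) hc hi

theorem dense_compl (hS : LocallyPlanar S) {C : Set S} (hC : C.Countable) : Dense Cᶜ := by
  rw [dense_iff_inter_open]
  rintro U hU ⟨x, hx⟩
  obtain ⟨e, he⟩ := hS x
  have h1 : IsOpen (e.target ∩ e.symm ⁻¹' U) := e.isOpen_inter_preimage_symm hU
  obtain ⟨z, hz, hzC⟩ := ((hC.image e).dense_compl ℝ).inter_open_nonempty _ h1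
    ⟨e x, e.map_source he, by simpa [e.left_inv he] using hx⟩
  exact ⟨e.symm z, hz.2, fun hc => hzC ⟨_, hc, e.right_inv hz.1⟩⟩

theorem exists_nhds_isPreconnected [T2Space S] (hS : LocallyPlanar S) {x : S} {V : Set S}
    (hV : V ∈ 𝓝 x) :
    ∃ P, IsOpen P ∧ x ∈ P ∧ IsPreconnected P ∧ IsPreconnected (P \ {x}) ∧
      IsCompact (closure P) ∧ closure P ⊆ V := by
  have := hS.locallyCompactSpace
  obtain ⟨K, hK, hKV, hKc⟩ := local_compact_nhds hV
  obtain ⟨e, he⟩ := hS x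
  have h2 : e.symm ⁻¹' K ∩ e.target ∈ 𝓝 (e x) := by
    refine inter_mem ((e.continuousAt_symm (e.map_source he)).preimage_mem_nhds ?_)
      (e.open_target.mem_nhds (e.map_source he))
    rwa [e.left_inv he]
  obtain ⟨r, hr, hball⟩ := Metric.nhds_basis_ball.mem_iff.1 h2
  have hsub : Metric.ball (e x) r ⊆ e.target := fun z hz => (hball hz).2
  have hcl : closure (e.symm '' Metric.ball (e x) r) ⊆ K := by
    refine closure_minimal ?_ hKc.isClosed
    rintro _ ⟨z, hz, rfl⟩
    exact (hball hz).1
  have hpunct : e.symm '' Metric.ball (e x) r \ {x} =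
      (e.symm ∘ OpenPartialHomeomorph.univBall (e x) r) '' {0}ᶜ := by
    have h3 : OpenPartialHomeomorph.univBall (e x) r '' {0}ᶜ = Metric.ball (e x) r \ {e x} := by
      have h4 := (OpenPartialHomeomorph.univBall (e x) r).image_source_eq_target
      have h5 := (OpenPartialHomeomorph.univBall (e x) r).injOn
      simp only [OpenPartialHomeomorph.univBall_source,
        OpenPartialHomeomorph.univBall_target _ hr] at h4 h5
      rw [compl_eq_univ_sdiff, h5.image_sdiff_subset (subset_univ _), h4, image_singleton,
        OpenPartialHomeomorph.univBall_apply_zero]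
    rw [image_comp, h3, (e.symm.injOn.mono hsub).image_sdiff_subset (singleton_subset_iff.2
      (Metric.mem_ball_self hr)), image_singleton, e.left_inv he]
  refine ⟨e.symm '' Metric.ball (e x) r, ?_, ?_, ?_, ?_,
    hKc.of_isClosed_subset isClosed_closure hcl,
    hcl.trans hKV⟩
  · exact e.symm.isOpen_image_of_subset_source Metric.isOpen_ball hsub
  · exact ⟨e x, Metric.mem_ball_self hr, e.left_inv he⟩
  · exact Metric.isPreconnected_ball.image _ (e.continuousOn_symm.mono hsub)
  · rw [hpunct]
    refine ((isConnected_compl_singleton_of_one_lt_rank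
      (by simp [Complex.rank_real_complex]) _).isPreconnected).image _ ?_
    refine ContinuousOn.comp (t := Metric.ball (e x) r) (e.continuousOn_symm.mono hsub)
      (OpenPartialHomeomorph.continuous_univBall _ _).continuousOn fun z _ => ?_
    have := (OpenPartialHomeomorph.univBall (e x) r).map_source (x := z) (by simp)
    rwa [OpenPartialHomeomorph.univBall_target _ hr] at this

/-- Removing a set that has no accumulation points in a connected open set leaves that open set
connected. -/
theorem isPreconnected_inter [T2Space S] (hS : LocallyPlanar S) {N G : Set S} (hN : IsOpen N)
    (hNc : IsPreconnected N) (hG : ∀ y ∈ N, G ∈ 𝓝[≠] y) : IsPreconnected (N ∩ G) := by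
  rintro A B hA hB hAB ⟨a, haNG, haA⟩ ⟨b, hbNG, hbB⟩
  -- a punctured neighbourhood on which a point of `N` accumulates
  have key : ∀ y ∈ N, ∀ V ∈ 𝓝 y, ∃ P ∈ 𝓝 y, P ⊆ V ∧ IsPreconnected (P \ {y}) ∧
      P \ {y} ⊆ N ∩ G := by
    intro y hy V hV
    obtain ⟨W, hW, hWG⟩ := mem_nhdsWithin_iff_exists_mem_nhds_inter.1 (hG y hy)
    obtain ⟨P, hPo, hyP, -, hP, -, hPV⟩ := hS.exists_nhds_isPreconnected
      (inter_mem hV (inter_mem hW (hN.mem_nhds hy)))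
    have hPV' := subset_closure.trans hPV
    exact ⟨P, hPo.mem_nhds hyP, fun z hz => (hPV' hz).1, hP,
      fun z hz => ⟨(hPV' hz.1).2.2, hWG ⟨(hPV' hz.1).2.1, hz.2⟩⟩⟩
  have hcov : N ⊆ closure (N ∩ G ∩ A) ∪ closure (N ∩ G ∩ B) := by
    intro y hy
    rw [← closure_union, ← inter_union_distrib_left, inter_eq_left.2 hAB, mem_closure_iff_nhds]
    intro V hV
    obtain ⟨P, hP, hPV, -, hPG⟩ := key y hy V hV
    have hne : (P \ {y}).Nonempty := by
      obtain ⟨z, hz⟩ := mem_closure_iff_nhds.1 (hS.dense_compl (countable_singleton y) y) P hP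
      exact ⟨z, hz⟩
    obtain ⟨z, hz⟩ := hne
    exact ⟨z, hPV hz.1, hPG hz⟩
  obtain ⟨y, hyN, hyA, hyB⟩ := isPreconnected_closed_iff.1 hNc _ _ isClosed_closure isClosed_closure
    hcov ⟨a, haNG.1, subset_closure ⟨haNG, haA⟩⟩ ⟨b, hbNG.1, subset_closure ⟨hbNG, hbB⟩⟩
  by_cases hyA' : y ∈ A
  · obtain ⟨z, hz, hz'⟩ := mem_closure_iff_nhds.1 hyB A (hA.mem_nhds hyA')
    exact ⟨z, hz'.1, hz, hz'.2⟩
  by_cases hyB' : y ∈ B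
  · obtain ⟨z, hz, hz'⟩ := mem_closure_iff_nhds.1 hyA B (hB.mem_nhds hyB')
    exact ⟨z, hz'.1, hz'.2, hz⟩
  obtain ⟨P, hP, -, hPc, hPG⟩ := key y hyN univ univ_mem
  have hne : ∀ D : Set S, y ∉ D → y ∈ closure (N ∩ G ∩ D) → ((P \ {y}) ∩ D).Nonempty := by
    intro D hD hyD
    obtain ⟨z, hz, hz'⟩ := mem_closure_iff_nhds.1 hyD P hP
    exact ⟨z, ⟨hz, fun h => hD (h ▸ hz'.2)⟩, hz'.2⟩
  obtain ⟨z, hz, hz'⟩ := hPc A B hA hB (hPG.trans hAB) (hne A hyA' hyA) (hne B hyB' hyB)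
  exact ⟨z, hPG hz, hz'⟩

end LocallyPlanar

theorem IsDiscrete.compl_mem_nhdsNE {S : Type*} [TopologicalSpace S] {E : Set S}
    (hE : IsDiscrete E) (hc : IsClosed E) (x : S) : Eᶜ ∈ 𝓝[≠] x := by
  by_cases hx : x ∈ E
  · have := isDiscrete_iff_nhdsNE.1 hE x hx
    exact (Filter.disjoint_principal_right).1 (disjoint_iff.2 this)
  · exact mem_nhdsWithin_of_mem_nhds (hc.isOpen_compl.mem_nhds hx)

theorem IsDiscrete.countable_of_secondCountable {S : Type*} [TopologicalSpace S]
    [SecondCountableTopology S] {E : Set S} (hE : IsDiscrete E) : E.Countable := by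
  have := hE.to_subtype
  exact TopologicalSpace.separableSpace_iff_countable.1 inferInstance

/-! ### Local injectivity, unique lifting and sections -/

/-- The map `f` is injective on some neighbourhood of `x`. For open continuous maps between
surfaces this is equivalent to having local degree `1` at `x`. -/
def LocInj {S R : Type*} [TopologicalSpace S] (f : S → R) (x : S) : Prop :=
  ∃ U ∈ 𝓝 x, InjOn f U

/-- `σ` is a continuous section of `f` over `D`; its values outside `D` are irrelevant. -/
structure IsSection {S R : Type*} [TopologicalSpace S] [TopologicalSpace R] (f : S → R)
    (D : Set R) (σ : R → S) : Prop where
  continuousOn : ContinuousOn σ D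
  apply_eq : ∀ q ∈ D, f (σ q) = q

section Lifting

variable {S R B : Type*} [TopologicalSpace S] [TopologicalSpace B] {f : S → R}

theorem LocInj.exists_isOpen {x : S} (h : LocInj f x) {V : Set S} (hV : V ∈ 𝓝 x) :
    ∃ U, IsOpen U ∧ x ∈ U ∧ U ⊆ V ∧ InjOn f U := by
  obtain ⟨U, hU, hi⟩ := h
  obtain ⟨W, hWU, hW, hx⟩ := mem_nhds_iff.1 (inter_mem hU hV)
  exact ⟨W, hW, hx, fun z hz => (hWU hz).2, hi.mono fun z hz => (hWU hz).1⟩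

/-- Two lifts of one map that meet at a point, one of which has its values among the points of
local injectivity, coincide on connected sets. -/
theorem eqOn_of_lifts [T2Space S] {φ ψ : B → S} {A : Set B} (hA : IsPreconnected A)
    (hφ : ContinuousOn φ A) (hψ : ContinuousOn ψ A) (hf : ∀ a ∈ A, f (φ a) = f (ψ a))
    (hi : ∀ a ∈ A, LocInj f (ψ a)) {a₀ : B} (ha₀ : a₀ ∈ A) (h₀ : φ a₀ = ψ a₀) : EqOn φ ψ A := by
  have := Subtype.preconnectedSpace hA
  have hφ' := continuousOn_iff_continuous_domRestrict.1 hφ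
  have hψ' := continuousOn_iff_continuous_domRestrict.1 hψ
  have hclopen : IsClopen {a : A | φ a = ψ a} := by
    refine ⟨isClosed_eq hφ' hψ', isOpen_iff_mem_nhds.2 fun a ha => ?_⟩
    obtain ⟨U, hU, hUi⟩ := hi a a.2
    have h1 : ∀ᶠ b : A in 𝓝 a, ψ b ∈ U := hψ'.continuousAt hU
    have h2 : ∀ᶠ b : A in 𝓝 a, φ b ∈ U := by
      refine hφ'.continuousAt ?_
      change U ∈ 𝓝 (φ a)
      rwa [show φ a = ψ a from ha]
    filter_upwards [h1, h2] with b hb1 hb2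
    exact hUi hb2 hb1 (hf b b.2)
  intro a ha
  have := (hclopen.eq_univ ⟨⟨a₀, ha₀⟩, h₀⟩).ge (mem_univ (⟨a, ha⟩ : A))
  exact this

variable [TopologicalSpace R]

theorem exists_isSection_of_injOn (ho : IsOpenMap f) {U : Set S} (hU : IsOpen U)
    (hi : InjOn f U) [Nonempty S] :
    ∃ τ : R → S, IsSection f (f '' U) τ ∧ ∀ x ∈ U, τ (f x) = x := by
  have hl : LeftInvOn (Function.invFunOn f U) f U := hi.leftInvOn_invFunOn
  refine ⟨_, ⟨(ho.domRestrict hU).continuousOn_image_of_leftInvOn hl, ?_⟩, hl⟩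
  rintro _ ⟨x, hx, rfl⟩
  rw [hl hx]

/-- Sections with values among the points of local injectivity are open. -/
theorem IsSection.isOpen_image (hf : Continuous f) {D V : Set R} {σ : R → S}
    (hσ : IsSection f D σ) (hi : ∀ q ∈ D, LocInj f (σ q)) (hV : IsOpen V) (hVD : V ⊆ D) :
    IsOpen (σ '' V) := by
  rw [isOpen_iff_mem_nhds]
  rintro _ ⟨q, hq, rfl⟩
  obtain ⟨U, hU, hUi⟩ := hi q (hVD hq)
  have h1 : ContinuousWithinAt σ V q := (hσ.continuousOn.mono hVD) q hq
  rw [ContinuousWithinAt, hV.nhdsWithin_eq hq] at h1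
  have h2 : ∀ᶠ x in 𝓝 (σ q), f x ∈ V ∧ σ (f x) ∈ U := by
    have h3 : Tendsto f (𝓝 (σ q)) (𝓝 q) := by
      have := hf.continuousAt (x := σ q)
      rwa [ContinuousAt, hσ.apply_eq q (hVD hq)] at this
    exact h3.eventually ((hV.eventually_mem hq).and (h1.eventually hU))
  filter_upwards [h2, hU] with x hx hxU
  exact ⟨f x, hx.1, hUi hx.2 hxU (hσ.apply_eq _ (hVD hx.1))⟩

/-- Continuation of a lift of a path through a point where `f` is injective on `U`. -/
theorem extend_lift (ho : IsOpenMap f) {β : ℝ → R} {γ : ℝ → S} {t s : ℝ} {U : Set S}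
    (hβ : ContinuousOn β (Icc t s)) (h0t : 0 ≤ t) (hts : t ≤ s) (hγ : ContinuousOn γ (Icc 0 t))
    (hl : ∀ r ∈ Icc 0 t, f (γ r) = β r) (hU : IsOpen U) (hi : InjOn f U) (hγt : γ t ∈ U)
    (hβU : ∀ r ∈ Icc t s, β r ∈ f '' U) :
    ∃ γ' : ℝ → S, ContinuousOn γ' (Icc 0 s) ∧ (∀ r ∈ Icc 0 s, f (γ' r) = β r) ∧ γ' 0 = γ 0 := by
  have : Nonempty S := ⟨γ t⟩
  obtain ⟨τ, hτ, hτ'⟩ := exists_isSection_of_injOn ho hU hi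
  refine ⟨fun r => if r ≤ t then γ r else τ (β r), ?_, ?_, by simp [h0t]⟩
  · have h1 : Icc 0 s = Icc 0 t ∪ Icc t s := (Icc_union_Icc_eq_Icc h0t hts).symm
    rw [h1]
    refine ContinuousOn.union_of_isClosed ?_ ?_ isClosed_Icc isClosed_Icc
    · exact hγ.congr fun r hr => if_pos hr.2
    · refine (hτ.continuousOn.comp hβ hβU).congr fun r hr => ?_
      rcases hr.1.eq_or_lt with rfl | h
      · simp only [le_refl, if_true, Function.comp]
        rw [← hl t ⟨h0t, le_rfl⟩, hτ' _ hγt]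
      · simp [not_le.2 h]
  · intro r hr
    by_cases h : r ≤ t
    · simpa [h] using hl r ⟨hr.1, h⟩
    · simpa [h] using hτ.apply_eq _ (hβU r ⟨(not_le.1 h).le, hr.2⟩)

/-- A path over which `f` is locally injective and which contains no asymptotic value lifts from
every initial point: at the end of a maximal lift there would be an asymptotic value. -/
theorem exists_lift_of_no_asymptotic [T2Space S] (hf : Continuous f) (ho : IsOpenMap f)
    {β : ℝ → R} (hβ : ContinuousOn β (Icc 0 1)) [T2Space R]
    (hi : ∀ x, f x ∈ β '' Icc 0 1 → LocInj f x)
    (has : ∀ s ∈ Icc (0 : ℝ) 1, ∀ γ : ℝ → S, ContinuousOn γ (Ico 0 1) →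
      (∀ K : Set S, IsCompact K → ∀ᶠ t in 𝓝[<] (1 : ℝ), γ t ∉ K) →
      ¬ Tendsto (fun t => f (γ t)) (𝓝[<] (1 : ℝ)) (𝓝 (β s)))
    {x₀ : S} (hx₀ : f x₀ = β 0) :
    ∃ γ : ℝ → S, ContinuousOn γ (Icc 0 1) ∧ (∀ r ∈ Icc (0 : ℝ) 1, f (γ r) = β r) ∧ γ 0 = x₀ := by
  set A : Set ℝ := {s | s ∈ Icc (0 : ℝ) 1 ∧ ∃ γ : ℝ → S, ContinuousOn γ (Icc 0 s) ∧
    (∀ r ∈ Icc 0 s, f (γ r) = β r) ∧ γ 0 = x₀} with hA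
  have hA0 : (0 : ℝ) ∈ A := by
    refine ⟨by simp, fun _ => x₀, continuousOn_const, ?_, rfl⟩
    intro r hr
    rw [le_antisymm hr.2 hr.1, hx₀]
  have hbdd : BddAbove A := ⟨1, fun s hs => hs.1.2⟩
  have hdown : ∀ s ∈ A, ∀ t ∈ Icc 0 s, t ∈ A := by
    rintro s ⟨hs, γ, h1, h2, h3⟩ t ht
    exact ⟨⟨ht.1, ht.2.trans hs.2⟩, γ, h1.mono (Icc_subset_Icc_right ht.2),
      fun r hr => h2 r ⟨hr.1, hr.2.trans ht.2⟩, h3⟩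
  set s := sSup A with hs
  have hs0 : 0 ≤ s := le_csSup hbdd hA0
  have hs1 : s ≤ 1 := csSup_le ⟨0, hA0⟩ fun t ht => ht.1.2
  -- a lift that comes close to a point `x` over `β s` reaches beyond `s`
  have step : ∀ x, f x = β s → (∀ U ∈ 𝓝 x, ∀ ε > 0, ∃ t ∈ Icc (s - ε) s, 0 ≤ t ∧ ∃ γ : ℝ → S,
      ContinuousOn γ (Icc 0 t) ∧ (∀ r ∈ Icc 0 t, f (γ r) = β r) ∧ γ 0 = x₀ ∧ γ t ∈ U) →
      (1 : ℝ) ∈ A := by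
    intro x hx hclose
    obtain ⟨U, hU, hxU, -, hUi⟩ := (hi x (hx ▸ mem_image_of_mem _ ⟨hs0, hs1⟩)).exists_isOpen
      univ_mem
    have hβs : ∀ᶠ r in 𝓝[Icc 0 1] s, β r ∈ f '' U :=
      (hβ s ⟨hs0, hs1⟩).eventually ((ho U hU).mem_nhds ⟨x, hxU, hx⟩)
    obtain ⟨ε, hε, hball⟩ := Metric.mem_nhdsWithin_iff.1 hβs
    obtain ⟨t, ht, ht0, γ, h1, h2, h3, h4⟩ := hclose U (hU.mem_nhds hxU) (ε / 2) (by linarith)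
    have hts' : t ≤ min 1 (s + ε / 2) := le_min (ht.2.trans hs1) (by linarith [ht.2])
    obtain ⟨γ', h5, h6, h7⟩ := extend_lift ho (s := min 1 (s + ε / 2))
      (hβ.mono fun r hr => ⟨ht0.trans hr.1, hr.2.trans (min_le_left _ _)⟩) ht0 hts' h1 h2 hU hUi h4
      (fun r hr => hball ⟨by
        rw [Metric.mem_ball, Real.dist_eq, abs_lt]
        have := hr.2.trans (min_le_right _ _)
        constructor <;> linarith [ht.1, hr.1], ht0.trans hr.1, hr.2.trans (min_le_left _ _)⟩)
    have hmem : min 1 (s + ε / 2) ∈ A :=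
      ⟨⟨ht0.trans hts', min_le_left _ _⟩, γ', h5, h6, h7.trans h3⟩
    have hle : min 1 (s + ε / 2) ≤ s := le_csSup hbdd hmem
    rcases min_le_iff.1 hle with h | h
    · have : min 1 (s + ε / 2) = 1 := min_eq_left (by linarith)
      rwa [this] at hmem
    · linarith
  suffices h : (1 : ℝ) ∈ A from h.2
  rcases hs0.eq_or_lt with h0 | hspos
  · refine step x₀ (by rw [hx₀, ← h0]) fun U hU ε hε => ⟨0, ⟨by linarith, hs0⟩, le_rfl, fun _ => x₀,
      continuousOn_const, ?_, rfl, mem_of_mem_nhds hU⟩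
    intro r hr
    rw [le_antisymm hr.2 hr.1, hx₀]
  -- the lifts over the intervals `[0, t]`, `t < s`, fit together
  have hlt : ∀ t ∈ Ico 0 s, t ∈ A := by
    intro t ht
    obtain ⟨t', ht', htt'⟩ := exists_lt_of_lt_csSup ⟨0, hA0⟩ ht.2
    exact hdown t' ht' t ⟨ht.1, htt'.le⟩
  have : Nonempty S := ⟨x₀⟩
  choose! Γ hΓ using fun t (ht : t ∈ Ico 0 s) => (hlt t ht).2
  have huniq : ∀ t ∈ Ico 0 s, ∀ r ∈ Icc 0 t, Γ r r = Γ t r := by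
    intro t ht r hr
    have hr' : r ∈ Ico 0 s := ⟨hr.1, hr.2.trans_lt ht.2⟩
    refine eqOn_of_lifts (f := f) (A := Icc 0 r) isPreconnected_Icc (hΓ r hr').1
      ((hΓ t ht).1.mono (Icc_subset_Icc_right hr.2)) ?_ ?_ (a₀ := 0) ⟨le_rfl, hr.1⟩
      ((hΓ r hr').2.2.trans (hΓ t ht).2.2.symm) ⟨hr.1, le_rfl⟩
    · intro a ha
      rw [(hΓ r hr').2.1 a ha, (hΓ t ht).2.1 a ⟨ha.1, ha.2.trans hr.2⟩]
    · intro a ha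
      refine hi _ ?_
      rw [(hΓ t ht).2.1 a ⟨ha.1, ha.2.trans hr.2⟩]
      exact mem_image_of_mem _ ⟨ha.1, (ha.2.trans (hr.2.trans ht.2.le)).trans hs1⟩
  have hdiag : ∀ t ∈ Ico 0 s, ContinuousOn (fun r => Γ r r) (Icc 0 t) := fun t ht =>
    (hΓ t ht).1.congr fun r hr => huniq t ht r hr
  have hdl : ∀ t ∈ Ico 0 s, f (Γ t t) = β t := fun t ht => (hΓ t ht).2.1 t ⟨ht.1, le_rfl⟩
  have hcont : ContinuousOn (fun r => Γ r r) (Ico 0 s) := by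
    intro t ht
    obtain ⟨t', htt', ht's⟩ := exists_between ht.2
    refine ((hdiag t' ⟨ht.1.trans htt'.le, ht's⟩) t ⟨ht.1, htt'.le⟩).mono_of_mem_nhdsWithin ?_
    filter_upwards [self_mem_nhdsWithin, mem_nhdsWithin_of_mem_nhds (Iio_mem_nhds htt')]
      with r hr hr'
    exact ⟨hr.1, hr'.le⟩
  have hmul : Tendsto (fun t : ℝ => s * t) (𝓝[<] 1) (𝓝[<] s) := by
    refine tendsto_nhdsWithin_iff.2 ⟨?_, ?_⟩
    · have : Tendsto (fun t : ℝ => s * t) (𝓝 1) (𝓝 (s * 1)) :=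
        (continuous_const.mul continuous_id).tendsto 1
      rw [mul_one] at this
      exact this.mono_left nhdsWithin_le_nhds
    · filter_upwards [self_mem_nhdsWithin] with t ht
      exact (mul_lt_iff_lt_one_right hspos).2 ht
  have hIco : Ico 0 s ∈ 𝓝[<] s := Ico_mem_nhdsLT hspos
  have hβlim : Tendsto (fun t => f (Γ t t)) (𝓝[<] s) (𝓝 (β s)) := by
    have h1 : Tendsto β (𝓝[<] s) (𝓝 (β s)) := by
      refine (hβ s ⟨hs0, hs1⟩).mono_left ?_
      rw [nhdsWithin_le_iff]
      exact mem_of_superset hIco fun r hr => ⟨hr.1, hr.2.le.trans hs1⟩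
    refine h1.congr' ?_
    filter_upwards [hIco] with t ht
    exact (hdl t ht).symm
  have hK : ∃ K : Set S, IsCompact K ∧ ∃ᶠ t in 𝓝[<] (1 : ℝ), Γ (s * t) (s * t) ∈ K := by
    by_contra! hcon
    refine has s ⟨hs0, hs1⟩ (fun t => Γ (s * t) (s * t)) ?_ ?_ (hβlim.comp hmul)
    · refine hcont.comp (by fun_prop) fun t ht => ⟨mul_nonneg hs0 ht.1, ?_⟩
      exact (mul_lt_iff_lt_one_right hspos).2 ht.2
    · intro K hK
      exact hcon K hK
  obtain ⟨K, hK, hfreq⟩ := hK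
  have hfreq' : ∃ᶠ t in 𝓝[<] s, Γ t t ∈ K := hmul.frequently hfreq
  obtain ⟨x, -, hx⟩ := hK.exists_mapClusterPt_of_frequently hfreq'
  have hfx : f x = β s := by
    have h1 : MapClusterPt (f x) (𝓝[<] s) (f ∘ fun t => Γ t t) :=
      hx.continuousAt_comp hf.continuousAt
    by_contra hne
    obtain ⟨V, W, hV, hW, hxV, hβW, hVW⟩ := t2_separation hne
    obtain ⟨t, ht, ht'⟩ := ((h1.frequently (hV.mem_nhds hxV)).and_eventually
      (hβlim.eventually (hW.mem_nhds hβW))).exists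
    exact disjoint_left.1 hVW ht ht'
  refine step x hfx fun U hU ε hε => ?_
  obtain ⟨t, ht, ht'', ht'⟩ := ((hx.frequently hU).and_eventually
    (inter_mem (Ico_mem_nhdsLT (show s - ε < s by linarith)) hIco)).exists
  exact ⟨t, ⟨ht''.1, ht''.2.le⟩, ht'.1, Γ t, (hΓ t ht').1, (hΓ t ht').2.1, (hΓ t ht').2.2, ht⟩

/-- Over an open disk on which lifts of paths exist, there is a section through every point. -/
theorem exists_isSection_of_isOpenEmbedding [T2Space S] [T2Space R] (hf : Continuous f)
    (ho : IsOpenMap f) {c : ℂ → R} (hc : IsOpenEmbedding c) (hi : ∀ x, f x ∈ range c → LocInj f x)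
    (has : ∀ q ∈ range c, ∀ γ : ℝ → S, ContinuousOn γ (Ico 0 1) →
      (∀ K : Set S, IsCompact K → ∀ᶠ t in 𝓝[<] (1 : ℝ), γ t ∉ K) →
      ¬ Tendsto (fun t => f (γ t)) (𝓝[<] (1 : ℝ)) (𝓝 q))
    {x₀ : S} (hx₀ : f x₀ ∈ range c) :
    ∃ σ : R → S, IsSection f (range c) σ ∧ σ (f x₀) = x₀ := by
  obtain ⟨z₀, hz₀⟩ := hx₀
  have hseg : ∀ z, ∃ γ : ℝ → S, ContinuousOn γ (Icc 0 1) ∧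
      (∀ r ∈ Icc (0 : ℝ) 1, f (γ r) = c (z₀ + r • (z - z₀))) ∧ γ 0 = x₀ := by
    intro z
    refine exists_lift_of_no_asymptotic hf ho (β := fun r => c (z₀ + r • (z - z₀))) ?_ ?_ ?_ ?_
    · exact (hc.continuous.comp (by fun_prop)).continuousOn
    · rintro x ⟨r, -, hr⟩
      exact hi x ⟨_, hr⟩
    · intro s _ γ h1 h2
      exact has _ ⟨_, rfl⟩ γ h1 h2
    · simp [hz₀]
  choose γ hγc hγl hγ0 using hseg
  let E := {x : S // f x ∈ range c}
  let p : E → R := fun x => f x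
  have hEo : IsOpen {x : S | f x ∈ range c} := hc.isOpen_range.preimage hf
  have hpo : IsOpenMap p := ho.comp hEo.isOpenMap_subtype_val
  have hpc : Continuous p := hf.comp continuous_subtype_val
  have hp : IsLocalHomeomorph p := by
    rw [isLocalHomeomorph_iff_isOpenEmbedding_restrict]
    rintro ⟨x, hx⟩
    obtain ⟨U, hU, hUi⟩ := hi x hx
    refine ⟨Subtype.val ⁻¹' interior U, (isOpen_interior.preimage continuous_subtype_val).mem_nhds
      (mem_interior_iff_mem_nhds.2 hU), ?_⟩
    refine IsOpenEmbedding.of_continuous_injective_isOpenMap (hpc.comp continuous_subtype_val) ?_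
      (hpo.domRestrict (isOpen_interior.preimage continuous_subtype_val))
    rintro ⟨a, ha⟩ ⟨b, hb⟩ hab
    exact Subtype.ext (Subtype.ext (hUi (interior_subset ha) (interior_subset hb) hab))
  let g : unitInterval × ℂ → E := fun tz => ⟨γ tz.2 tz.1, by
    rw [hγl _ _ tz.1.2]; exact mem_range_self _⟩
  have hg : Continuous g := by
    refine hp.continuous_lift (T2Space.isSeparatedMap p)
      (f := ⟨fun tz : unitInterval × ℂ => c (z₀ + (tz.1 : ℝ) • (tz.2 - z₀)),
        hc.continuous.comp (by fun_prop)⟩) ?_ ?_ ?_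
    · funext tz
      exact hγl _ _ tz.1.2
    · refine continuous_induced_rng.2 ?_
      refine (continuous_const (y := x₀)).congr fun z => ?_
      exact (hγ0 z).symm
    · intro z
      refine continuous_induced_rng.2 ?_
      exact (hγc z).comp_continuous continuous_subtype_val fun t => t.2
  have hσ : IsSection f (range c) fun q => γ (Function.invFun c q) 1 := by
    refine ⟨?_, ?_⟩
    · have h1 : ContinuousOn (Function.invFun c) (range c) := by
        rw [← image_univ]
        exact (hc.isOpenMap.domRestrict isOpen_univ).continuousOn_image_of_leftInvOn
          fun z _ => Function.leftInverse_invFun hc.injective z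
      have h2 : Continuous fun z => γ z 1 :=
        continuous_subtype_val.comp (hg.comp (Continuous.prodMk_right (1 : unitInterval)))
      exact h2.comp_continuousOn h1
    · rintro _ ⟨z, rfl⟩
      rw [Function.leftInverse_invFun hc.injective z, hγl z 1 (by simp)]
      simp
  refine ⟨_, hσ, ?_⟩
  have h1 : EqOn (γ z₀) (fun _ => x₀) (Icc 0 1) := by
    refine eqOn_of_lifts (f := f) isPreconnected_Icc (hγc z₀) continuousOn_const ?_ ?_ (a₀ := 0)
      (by simp) (hγ0 z₀)
    · intro a ha
      rw [hγl z₀ a ha, ← hz₀]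
      simp
    · intro a _
      exact hi _ ⟨z₀, hz₀⟩
  change γ (Function.invFun c (f x₀)) 1 = x₀
  rw [← hz₀, Function.leftInverse_invFun hc.injective z₀]
  exact h1 (by simp)

end Lifting

/-! ### The Riemann sphere -/

/-- The inversion `z ↦ 1 / z` of the Riemann sphere. -/
def sphereInv (q : RSphere) : RSphere :=
  q.elim ((0 : ℂ) : RSphere) fun z => if z = 0 then OnePoint.infty else ((z⁻¹ : ℂ) : RSphere)

theorem sphereInv_coe {z : ℂ} (hz : z ≠ 0) : sphereInv (z : RSphere) = ((z⁻¹ : ℂ) : RSphere) :=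
  if_neg hz

theorem sphereInv_zero : sphereInv ((0 : ℂ) : RSphere) = OnePoint.infty := if_pos rfl

theorem sphereInv_infty : sphereInv OnePoint.infty = ((0 : ℂ) : RSphere) := rfl

theorem sphereInv_involutive : Function.Involutive sphereInv := by
  intro q
  induction q using OnePoint.rec with
  | infty => rw [sphereInv_infty, sphereInv_zero]
  | coe z =>
    by_cases hz : z = 0
    · rw [hz, sphereInv_zero, sphereInv_infty]
    · rw [sphereInv_coe hz, sphereInv_coe (inv_ne_zero hz), inv_inv]

theorem continuous_sphereInv : Continuous sphereInv := by
  rw [OnePoint.continuous_iff, coclosedCompact_eq_cocompact, ← Metric.cobounded_eq_cocompact]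
  constructor
  · rw [sphereInv_infty]
    have h1 : Tendsto (fun z : ℂ => ((z⁻¹ : ℂ) : RSphere)) (Bornology.cobounded ℂ)
        (𝓝 ((0 : ℂ) : RSphere)) :=
      (OnePoint.continuous_coe.tendsto (0 : ℂ)).comp tendsto_inv₀_cobounded
    refine h1.congr' ?_
    filter_upwards [Bornology.eventually_ne_cobounded (0 : ℂ)] with z hz
    exact (sphereInv_coe hz).symm
  · rw [continuous_iff_continuousAt]
    intro z
    by_cases hz : z = 0
    · rw [hz, continuousAt_iff_punctured_nhds]
      simp only [sphereInv_zero]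
      have h1 : Tendsto (fun z : ℂ => ((z⁻¹ : ℂ) : RSphere)) (𝓝[≠] 0) (𝓝 OnePoint.infty) := by
        refine OnePoint.tendsto_coe_infty.comp ?_
        rw [coclosedCompact_eq_cocompact, ← Metric.cobounded_eq_cocompact]
        exact tendsto_inv₀_nhdsNE_zero
      refine h1.congr' ?_
      filter_upwards [self_mem_nhdsWithin] with w hw
      exact (sphereInv_coe hw).symm
    · have h1 : ContinuousAt (fun z : ℂ => ((z⁻¹ : ℂ) : RSphere)) z :=
        OnePoint.continuous_coe.continuousAt.comp (continuousAt_inv₀ hz)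
      refine h1.congr ?_
      filter_upwards [isOpen_ne.mem_nhds hz] with w hw
      exact (sphereInv_coe hw).symm

theorem exists_isOpenEmbedding_sphere (q : RSphere) :
    ∃ c : ℂ → RSphere, IsOpenEmbedding c ∧ q ∈ range c := by
  induction q using OnePoint.rec with
  | infty =>
    refine ⟨sphereInv ∘ (↑), IsOpenEmbedding.comp ?_ OnePoint.isOpenEmbedding_coe, 0,
      sphereInv_zero⟩
    exact (Homeomorph.mk sphereInv_involutive.toPerm continuous_sphereInv
      continuous_sphereInv).isOpenEmbedding
  | coe z => exact ⟨_, OnePoint.isOpenEmbedding_coe, mem_range_self z⟩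

theorem exists_isOpenEmbedding_range_subset {q : RSphere} {V : Set RSphere} (hV : V ∈ 𝓝 q) :
    ∃ c : ℂ → RSphere, IsOpenEmbedding c ∧ q ∈ range c ∧ range c ⊆ V := by
  obtain ⟨c, hc, z, rfl⟩ := exists_isOpenEmbedding_sphere q
  obtain ⟨r, hr, hball⟩ := Metric.mem_nhds_iff.1 (hc.continuous.continuousAt.preimage_mem_nhds hV)
  have h1 : IsOpenEmbedding (OpenPartialHomeomorph.univBall z r) :=
    (OpenPartialHomeomorph.univBall z r).isOpenEmbedding
      (OpenPartialHomeomorph.univBall_source z r)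
  refine ⟨c ∘ OpenPartialHomeomorph.univBall z r, hc.comp h1, ⟨0, by simp⟩, ?_⟩
  rintro _ ⟨w, rfl⟩
  have := (OpenPartialHomeomorph.univBall z r).map_source (x := w) (by simp)
  rw [OpenPartialHomeomorph.univBall_target _ hr] at this
  exact hball this

/-! ### Regular values of surfaces spread over the sphere -/

theorem locInj_of_not_isCriticalPoint {S : Type u} [TopologicalSpace S] {f : S → RSphere} {x : S}
    (h : ¬ IsCriticalPoint f x) : LocInj f x := by
  obtain ⟨-, U, hxU, hU, h₁, h₂, -, -, h₃⟩ := not_not.1 h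
  refine ⟨U, hU.mem_nhds hxU, fun a ha b hb hab => ?_⟩
  have h4 : (h₁ ⟨a, ha⟩ : ℂ) = h₁ ⟨b, hb⟩ := by
    have ea := h₃ ⟨a, ha⟩
    have eb := h₃ ⟨b, hb⟩
    rw [pow_one] at ea eb
    rw [← ea, ← eb]
    congr 2
    exact Subtype.ext hab
  exact congrArg Subtype.val (h₁.injective (Subtype.ext h4))

namespace SpreadSurface

/-- The singular values of the projection. -/
def singularValues (X : SpreadSurface.{u}) : Set RSphere := {a | IsSingularValue X.proj a}

theorem locallyPlanar (X : SpreadSurface.{u}) : LocallyPlanar X.carrier := X.chart_at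

theorem locInj_of_notMem_singularValues (X : SpreadSurface.{u}) {x : X.carrier}
    (hx : X.proj x ∉ X.singularValues) : LocInj X.proj x :=
  locInj_of_not_isCriticalPoint fun h => hx (Or.inl ⟨x, h, rfl⟩)

/-- Every point that is not a singular value has a connected open neighbourhood such that there
are sections over it through all points above it. -/
theorem exists_regular_nhds (X : SpreadSurface.{u}) (hX : IsClosed X.singularValues) {q : RSphere}
    (hq : q ∉ X.singularValues) :
    ∃ D, IsOpen D ∧ q ∈ D ∧ IsPreconnected D ∧ D ⊆ X.singularValuesᶜ ∧
      ∀ x, X.proj x ∈ D → ∃ σ, IsSection X.proj D σ ∧ σ (X.proj x) = x := by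
  obtain ⟨c, hc, hqc, hcQ⟩ := exists_isOpenEmbedding_range_subset (hX.isOpen_compl.mem_nhds hq)
  refine ⟨range c, hc.isOpen_range, hqc, isPreconnected_range hc.continuous, hcQ, fun x hx => ?_⟩
  refine exists_isSection_of_isOpenEmbedding X.continuous_proj X.isOpenMap_proj hc ?_ ?_ hx
  · exact fun x hx => X.locInj_of_notMem_singularValues (hcQ hx)
  · exact fun q hq γ h1 h2 h3 => hcQ hq (Or.inr ⟨γ, h1, h2, h3⟩)

end SpreadSurface

theorem LocallyPlanar.nhdsNE_neBot {S : Type*} [TopologicalSpace S] (hS : LocallyPlanar S)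
    (x : S) : (𝓝[≠] x).NeBot :=
  mem_closure_iff_nhdsWithin_neBot.1 (hS.dense_compl (countable_singleton x) x)

/-- A set without accumulation points pulls back to such a set under a continuous map with
discrete fibres. -/
theorem preimage_compl_mem_nhdsNE {S R : Type*} [TopologicalSpace S]
    [TopologicalSpace R] {h : S → R} {x : S} {E : Set R} (hh : ContinuousAt h x)
    (hE : Eᶜ ∈ 𝓝[≠] (h x)) (hne : ∀ᶠ z in 𝓝[≠] x, h z ≠ h x) : h ⁻¹' Eᶜ ∈ 𝓝[≠] x := by
  have : Tendsto h (𝓝[≠] x) (𝓝[≠] (h x)) :=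
    tendsto_nhdsWithin_iff.2 ⟨hh.mono_left nhdsWithin_le_nhds, hne⟩
  exact this hE

theorem SpreadSurface.eventually_proj_ne (X : SpreadSurface.{u}) (x : X.carrier) :
    ∀ᶠ z in 𝓝[≠] x, X.proj z ≠ X.proj x :=
  (X.discrete_proj (X.proj x)).compl_mem_nhdsNE (isClosed_singleton.preimage X.continuous_proj) x

/-! ### Relations with closed graph -/

section ClosedRelation

variable {S S' : Type*} [TopologicalSpace S] [TopologicalSpace S'] {Γ : Set (S × S')}

theorem eventually_forall_notMem (hΓ : IsClosed Γ) {K : Set S'} (hK : IsCompact K) {x : S}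
    (hx : ∀ y ∈ K, (x, y) ∉ Γ) : ∀ᶠ x' in 𝓝 x, ∀ y ∈ K, (x', y) ∉ Γ :=
  hK.eventually_forall_of_forall_eventually (P := fun x' y => (x', y) ∉ Γ)
    fun y hy => hΓ.isOpen_compl.mem_nhds (hx y hy)

theorem isClosed_setOf_exists_mem (hΓ : IsClosed Γ) {K : Set S'} (hK : IsCompact K) :
    IsClosed {x | ∃ y ∈ K, (x, y) ∈ Γ} := by
  rw [← isOpen_compl_iff, isOpen_iff_mem_nhds]
  intro x hx
  filter_upwards [eventually_forall_notMem hΓ hK (x := x) fun y hy h => hx ⟨y, hy, h⟩] with x' hx'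
  rintro ⟨y, hy, h⟩
  exact hx' y hy h

theorem continuousOn_of_isClosed_graph [T2Space S'] (hΓ : IsClosed Γ) {K : Set S'}
    (hK : IsCompact K) {h : S → S'} {B : Set S} (hB : ∀ x ∈ B, h x ∈ K ∧ (x, h x) ∈ Γ)
    (hu : ∀ x ∈ B, ∀ y ∈ K, (x, y) ∈ Γ → y = h x) : ContinuousOn h B := by
  intro x hx V hV
  obtain ⟨W, hWV, hW, hxW⟩ := mem_nhds_iff.1 hV
  have := eventually_forall_notMem hΓ (hK.diff hW) (x := x) fun y hy h =>
    hy.2 (hu x hx y hy.1 h ▸ hxW)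
  rw [mem_map]
  filter_upwards [nhdsWithin_le_nhds this, self_mem_nhdsWithin] with z hz hzB
  by_contra hzV
  exact hz (h z) ⟨(hB z hzB).1, fun h => hzV (hWV h)⟩ (hB z hzB).2

end ClosedRelation

/-! ### The maximal extension of an injective fibre-preserving map -/

/-- The topological conditions under which two surfaces spread over the sphere can be glued
along a relation `Γ`: it is the graph of a fibre-preserving homeomorphism between open subsets,
and this graph is closed. -/
structure IsGluing (X Y : SpreadSurface.{u}) (Γ : Set (X.carrier × Y.carrier)) : Prop where
  isClosed : IsClosed Γ
  proj_eq : ∀ x y, (x, y) ∈ Γ → X.proj x = Y.proj y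
  left_unique : ∀ x x' y, (x, y) ∈ Γ → (x', y) ∈ Γ → x = x'
  right_unique : ∀ x y y', (x, y) ∈ Γ → (x, y') ∈ Γ → y = y'
  exists_local : ∀ x y, (x, y) ∈ Γ → ∃ B : Set X.carrier, ∃ h : X.carrier → Y.carrier,
    IsOpen B ∧ x ∈ B ∧ ContinuousOn h B ∧ InjOn h B ∧ h x = y ∧ ∀ b ∈ B, (b, h b) ∈ Γ

section Extension

variable {X Y : SpreadSurface.{u}} {F : Set Y.carrier} {g : Y.carrier → X.carrier}

/-- The closure of the graph of `g` on the complement of `F`. -/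
def closureGraph (F : Set Y.carrier) (g : Y.carrier → X.carrier) :
    Set (X.carrier × Y.carrier) := closure ((fun y => (g y, y)) '' Fᶜ)

theorem mem_closureGraph {y : Y.carrier} (hy : y ∉ F) : (g y, y) ∈ closureGraph F g :=
  subset_closure (mem_image_of_mem _ hy)

theorem proj_eq_of_mem_closureGraph (hg : ∀ y ∉ F, X.proj (g y) = Y.proj y) {x : X.carrier}
    {y : Y.carrier} (h : (x, y) ∈ closureGraph F g) : X.proj x = Y.proj y := by
  have hc : IsClosed {p : X.carrier × Y.carrier | X.proj p.1 = Y.proj p.2} :=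
    isClosed_eq (X.continuous_proj.comp continuous_fst) (Y.continuous_proj.comp continuous_snd)
  refine closure_minimal ?_ hc h
  rintro _ ⟨z, hz, rfl⟩
  exact hg z hz

theorem eq_of_mem_closureGraph (hF : IsClosed F) (hgc : ContinuousOn g Fᶜ) {x : X.carrier}
    {y : Y.carrier} (hy : y ∉ F) (h : (x, y) ∈ closureGraph F g) : x = g y := by
  by_contra hne
  obtain ⟨V, W, hV, hW, hxV, hgW, hVW⟩ := t2_separation hne
  have h1 : Fᶜ ∩ g ⁻¹' W ∈ 𝓝 y :=
    inter_mem (hF.isOpen_compl.mem_nhds hy)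
      ((hgc.continuousAt (hF.isOpen_compl.mem_nhds hy)).preimage_mem_nhds (hW.mem_nhds hgW))
  obtain ⟨_, hz, z, hzF, rfl⟩ := mem_closure_iff_nhds.1 h _ (prod_mem_nhds (hV.mem_nhds hxV) h1)
  exact disjoint_left.1 hVW hz.1 hz.2.2

theorem exists_local_inverse (hF : IsClosed F) (hFd : IsDiscrete F) (hgc : ContinuousOn g Fᶜ)
    (hgi : InjOn g Fᶜ) (hg : ∀ y ∉ F, X.proj (g y) = Y.proj y) {x₀ : X.carrier} {y₀ : Y.carrier}
    (h₀ : (x₀, y₀) ∈ closureGraph F g) :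
    ∃ B : Set X.carrier, ∃ h : X.carrier → Y.carrier, IsOpen B ∧ x₀ ∈ B ∧ ContinuousOn h B ∧
      InjOn h B ∧ h x₀ = y₀ ∧ ∀ b ∈ B, (b, h b) ∈ closureGraph F g := by
  have hopen : ∀ V, IsOpen V → IsOpen (g '' (V ∩ Fᶜ)) := fun V hV =>
    Y.locallyPlanar.isOpen_image X.locallyPlanar (hV.inter hF.isOpen_compl)
      (hgc.mono inter_subset_right) (hgi.mono inter_subset_right)
  by_cases hy₀ : y₀ ∉ F
  · have : Nonempty Y.carrier := ⟨y₀⟩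
    have hl : LeftInvOn (Function.invFunOn g Fᶜ) g Fᶜ := hgi.leftInvOn_invFunOn
    have ho : IsOpenMap (Fᶜ.domRestrict g) := by
      rintro _ ⟨V, hV, rfl⟩
      have h1 : Fᶜ.domRestrict g '' (Subtype.val ⁻¹' V) = g '' (V ∩ Fᶜ) := by
        ext x
        constructor
        · rintro ⟨y, hy, rfl⟩
          exact ⟨y, ⟨hy, y.2⟩, rfl⟩
        · rintro ⟨y, hy, rfl⟩
          exact ⟨⟨y, hy.2⟩, hy.1, rfl⟩
      rw [h1]
      exact hopen V hV
    rw [eq_of_mem_closureGraph hF hgc hy₀ h₀]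
    refine ⟨g '' Fᶜ, Function.invFunOn g Fᶜ, ?_, mem_image_of_mem g hy₀,
      ho.continuousOn_image_of_leftInvOn hl, ?_, hl hy₀, ?_⟩
    · simpa using hopen univ isOpen_univ
    · rintro _ ⟨y, hy, rfl⟩ _ ⟨y', hy', rfl⟩ hyy'
      rw [hl hy, hl hy'] at hyy'
      rw [hyy']
    · rintro _ ⟨y, hy, rfl⟩
      rw [hl hy]
      exact mem_closureGraph hy
  rw [not_not] at hy₀
  have hΓ : IsClosed (closureGraph F g) := isClosed_closure
  have hq := proj_eq_of_mem_closureGraph hg h₀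
  -- a neighbourhood of `y₀` in which `y₀` is the only point of `F` and of its fibre
  have hV : (F ∪ Y.proj ⁻¹' {Y.proj y₀})ᶜ ∪ {y₀} ∈ 𝓝 y₀ := by
    rw [compl_union]
    have := inter_mem (hFd.compl_mem_nhdsNE hF y₀) (Y.eventually_proj_ne y₀)
    rw [union_comm]
    exact insert_mem_nhds_iff.2 this
  obtain ⟨N, hN, hyN, -, -, hNc, hNV⟩ := Y.locallyPlanar.exists_nhds_isPreconnected hV
  have hNF : ∀ y ∈ closure N, y ≠ y₀ → y ∉ F ∧ Y.proj y ≠ Y.proj y₀ := by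
    intro y hy hne
    have := (hNV hy).resolve_right hne
    exact ⟨fun h => this (Or.inl h), fun h => this (Or.inr h)⟩
  have hfr : IsCompact (closure N \ N) := hNc.diff hN
  have hD : IsOpen (Y.proj '' (closure N \ N))ᶜ :=
    (hfr.image Y.continuous_proj).isClosed.isOpen_compl
  have hqD : Y.proj y₀ ∈ (Y.proj '' (closure N \ N))ᶜ := by
    rintro ⟨y, hy, hyq⟩
    exact (hNF y hy.1 fun h => hy.2 (h ▸ hyN)).2 hyq
  have hV' : X.proj ⁻¹' (Y.proj '' (closure N \ N))ᶜ ∩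
      ((X.proj ⁻¹' {X.proj x₀})ᶜ ∪ {x₀}) ∈ 𝓝 x₀ := by
    refine inter_mem ((hD.preimage X.continuous_proj).mem_nhds (by rwa [mem_preimage, hq])) ?_
    rw [union_comm]
    exact insert_mem_nhds_iff.2 (X.eventually_proj_ne x₀)
  obtain ⟨B, hB, hxB, -, hBp, -, hBV⟩ := X.locallyPlanar.exists_nhds_isPreconnected hV'
  replace hBV := subset_closure.trans hBV
  have hBq : ∀ x ∈ B, X.proj x = X.proj x₀ → x = x₀ := fun x hx h =>
    (hBV hx).2.resolve_left fun h' => h' h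
  have hV₁ : IsOpen (g '' (N ∩ Fᶜ)) := hopen N hN
  have hpunct : ∀ x ∈ B \ {x₀}, ∀ y ∈ closure N, (x, y) ∈ closureGraph F g →
      y ∈ N ∩ Fᶜ ∧ x = g y := by
    intro x hx y hy hxy
    have h1 := proj_eq_of_mem_closureGraph hg hxy
    have h2 : y ∈ N := by
      by_contra h
      exact (hBV hx.1).1 ⟨y, ⟨hy, h⟩, h1.symm⟩
    have h3 : y ≠ y₀ := by
      rintro rfl
      exact hx.2 (hBq x hx.1 (h1.trans hq.symm))
    have h4 := (hNF y hy h3).1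
    exact ⟨⟨h2, h4⟩, eq_of_mem_closureGraph hF hgc h4 hxy⟩
  -- `B \ {x₀}` is connected and its intersection with the image of `g` is open and closed
  have hsub : B \ {x₀} ⊆ g '' (N ∩ Fᶜ) := by
    refine hBp.subset_left_of_subset_union hV₁
      (isClosed_setOf_exists_mem hΓ hNc).isOpen_compl ?_ ?_ ?_
    · rw [disjoint_left]
      rintro _ ⟨y, hy, rfl⟩ h
      exact h ⟨y, subset_closure hy.1, mem_closureGraph hy.2⟩
    · intro x hx
      by_cases h : ∃ y ∈ closure N, (x, y) ∈ closureGraph F g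
      · obtain ⟨y, hy, hxy⟩ := h
        obtain ⟨h1, rfl⟩ := hpunct x hx y hy hxy
        exact Or.inl ⟨y, h1, rfl⟩
      · exact Or.inr h
    · obtain ⟨_, hz, z, hzF, rfl⟩ := mem_closure_iff_nhds.1 h₀ _
        (prod_mem_nhds (hB.mem_nhds hxB) (hN.mem_nhds hyN))
      refine ⟨g z, ⟨hz.1, fun h => ?_⟩, z, ⟨hz.2, hzF⟩, rfl⟩
      have h1 : X.proj (g z) = X.proj x₀ := congrArg X.proj h
      rw [hg z hzF, hq] at h1
      exact (hNF z (subset_closure hz.2) fun h2 => hzF (h2 ▸ hy₀)).2 h1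
  have hex : ∀ x ∈ B, ∃ y, y ∈ closure N ∧ (x, y) ∈ closureGraph F g := by
    intro x hx
    by_cases hxx : x = x₀
    · exact ⟨y₀, subset_closure hyN, hxx ▸ h₀⟩
    · obtain ⟨y, hy, rfl⟩ := hsub ⟨hx, hxx⟩
      exact ⟨y, subset_closure hy.1, mem_closureGraph hy.2⟩
  have : Nonempty Y.carrier := ⟨y₀⟩
  choose! h hh using hex
  have hu : ∀ x ∈ B, ∀ y ∈ closure N, (x, y) ∈ closureGraph F g → y = h x := by
    intro x hx y hy hxy
    by_cases hxx : x = x₀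
    · -- the only point of `closure N` in the fibre of `y₀` is `y₀`
      have key : ∀ z ∈ closure N, (x, z) ∈ closureGraph F g → z = y₀ := by
        intro z hz hxz
        by_contra hne
        refine (hNF z hz hne).2 ?_
        rw [← proj_eq_of_mem_closureGraph hg hxz, hxx, hq]
      rw [key y hy hxy, key (h x) (hh x hx).1 (hh x hx).2]
    · obtain ⟨h1, h2⟩ := hpunct x ⟨hx, hxx⟩ y hy hxy
      obtain ⟨h3, h4⟩ := hpunct x ⟨hx, hxx⟩ _ (hh x hx).1 (hh x hx).2
      exact hgi h1.2 h3.2 (h2.symm.trans h4)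
  refine ⟨B, h, hB, hxB, continuousOn_of_isClosed_graph hΓ hNc hh hu, ?_,
    (hu x₀ hxB y₀ (subset_closure hyN) h₀).symm, fun b hb => (hh b hb).2⟩
  intro a ha b hb hab
  have key : ∀ c ∈ B, h c ∈ F → c = x₀ := by
    intro c hc hcF
    refine hBq c hc ?_
    have h1 : h c = y₀ := by
      by_contra hne
      exact (hNF _ (hh c hc).1 hne).1 hcF
    rw [proj_eq_of_mem_closureGraph hg (hh c hc).2, h1, hq]
  by_cases haF : h a ∈ F
  · rw [key a ha haF, key b hb (hab ▸ haF)]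
  · rw [eq_of_mem_closureGraph hF hgc haF (hh a ha).2,
      eq_of_mem_closureGraph hF hgc (hab ▸ haF) (hh b hb).2, hab]

/-- The closure of the graph of a continuous injective fibre-preserving map that is defined off a
set `F` without accumulation points is a gluing relation. Over a point of `F` to which the closed
graph extends, the graph contains a whole punctured neighbourhood, by connectedness, and so
invariance of domain applies. -/
theorem isGluing_closureGraph (hF : IsClosed F) (hFd : IsDiscrete F) (hgc : ContinuousOn g Fᶜ)
    (hgi : InjOn g Fᶜ) (hg : ∀ y ∉ F, X.proj (g y) = Y.proj y) :
    IsGluing X Y (closureGraph F g) := by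
  have hloc := fun x y (h : (x, y) ∈ closureGraph F g) =>
    exists_local_inverse hF hFd hgc hgi hg h
  refine ⟨isClosed_closure, fun x y h => proj_eq_of_mem_closureGraph hg h, ?_, ?_, hloc⟩
  · intro x x' y hx hx'
    by_contra hne
    obtain ⟨V, V', hV, hV', hxV, hxV', hVV'⟩ := t2_separation hne
    obtain ⟨B, h, hB, hxB, hc, hi, hxy, hgr⟩ := hloc x y hx
    obtain ⟨B', h', hB', hxB', hc', hi', hxy', hgr'⟩ := hloc x' y hx'
    have h1 := X.locallyPlanar.image_mem_nhds Y.locallyPlanar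
      ((hB.inter hV).mem_nhds ⟨hxB, hxV⟩) (hc.mono inter_subset_left) (hi.mono inter_subset_left)
    have h2 := X.locallyPlanar.image_mem_nhds Y.locallyPlanar ((hB'.inter hV').mem_nhds
      ⟨hxB', hxV'⟩) (hc'.mono inter_subset_left) (hi'.mono inter_subset_left)
    rw [hxy] at h1
    rw [hxy'] at h2
    have := Y.locallyPlanar.nhdsNE_neBot y
    obtain ⟨z, hzF, ⟨b, hb, hbz⟩, b', hb', hbz'⟩ := (Filter.nonempty_of_mem
      (inter_mem (hFd.compl_mem_nhdsNE hF y) (nhdsWithin_le_nhds (inter_mem h1 h2))))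
    have e1 := eq_of_mem_closureGraph hF hgc hzF (hbz ▸ hgr b hb.1)
    have e2 := eq_of_mem_closureGraph hF hgc hzF (hbz' ▸ hgr' b' hb'.1)
    exact disjoint_left.1 hVV' hb.2 (e1.trans e2.symm ▸ hb'.2)
  · intro x y y' hy hy'
    obtain ⟨B, h, hB, hxB, hc, hi, rfl, hgr⟩ := hloc x y hy
    obtain ⟨B', h', hB', hxB', hc', hi', rfl, hgr'⟩ := hloc x y' hy'
    have hne : ∀ {B : Set X.carrier} {h : X.carrier → Y.carrier}, IsOpen B → x ∈ B →
        ContinuousOn h B → InjOn h B → h ⁻¹' Fᶜ ∈ 𝓝[≠] x := by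
      intro B h hB hxB hc hi
      refine preimage_compl_mem_nhdsNE (hc.continuousAt (hB.mem_nhds hxB))
        (hFd.compl_mem_nhdsNE hF _) ?_
      filter_upwards [nhdsWithin_le_nhds (hB.mem_nhds hxB), self_mem_nhdsWithin] with z hz hzx
      exact fun h => hzx (hi hz hxB h)
    have := X.locallyPlanar.nhdsNE_neBot x
    have t1 : Tendsto h (𝓝[≠] x) (𝓝 (h x)) :=
      (hc.continuousAt (hB.mem_nhds hxB)).mono_left nhdsWithin_le_nhds
    have t2 : Tendsto h' (𝓝[≠] x) (𝓝 (h' x)) :=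
      (hc'.continuousAt (hB'.mem_nhds hxB')).mono_left nhdsWithin_le_nhds
    refine tendsto_nhds_unique t1 (t2.congr' ?_)
    filter_upwards [hne hB hxB hc hi, hne hB' hxB' hc' hi', nhdsWithin_le_nhds (hB.mem_nhds hxB),
      nhdsWithin_le_nhds (hB'.mem_nhds hxB')] with z hz hz' hzB hzB'
    exact hgi hz' hz ((eq_of_mem_closureGraph hF hgc hz' (hgr' z hzB')).symm.trans
      (eq_of_mem_closureGraph hF hgc hz (hgr z hzB)))

end Extension

/-! ### Limit maps into a sequence of pointed surfaces -/

/-- A sequence of maps `φ n` from `X` to the surfaces `T n` that witnesses `CompactsEmbed T X`, with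
exceptional set `E`: on each compact set in the complement of `E`, all but finitely many of them
are embeddings over the sphere. Outside that compact set `φ n` is arbitrary. -/
structure IsLimitMap (T : ℕ → PointedSurface.{u}) (X : PointedSurface.{u}) (E : Set X.carrier)
    (φ : ∀ n, X.carrier → (T n).carrier) : Prop where
  isClosed : IsClosed E
  isDiscrete : IsDiscrete E
  pt_notMem : X.pt ∉ E
  eventually_pt : ∀ᶠ n in atTop, φ n X.pt = (T n).pt
  eventually : ∀ K : Set X.carrier, IsCompact K → K ⊆ Eᶜ → ∀ᶠ n in atTop,
    ContinuousOn (φ n) K ∧ InjOn (φ n) K ∧ ∀ x ∈ K, (T n).proj (φ n x) = X.proj x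

/-- A diagonal choice along an exhaustion of the complement of `E` by compact sets. -/
theorem CompactsEmbed.exists_isLimitMap {T : ℕ → PointedSurface.{u}} {X : PointedSurface.{u}}
    (h : CompactsEmbed T X) : ∃ E φ, IsLimitMap T X E φ := by
  obtain ⟨E, hE, hEd, hpt, h⟩ := h
  have := X.locallyPlanar.locallyCompactSpace
  have : LocallyCompactSpace (Eᶜ : Set X.carrier) := hE.isOpen_compl.locallyCompactSpace
  let κ : CompactExhaustion (Eᶜ : Set X.carrier) := default
  let K : ℕ → Set X.carrier := fun m => insert X.pt (Subtype.val '' κ m)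
  have hK : ∀ m, IsCompact (K m) := fun m =>
    ((κ.isCompact m).image continuous_subtype_val).insert _
  have hKE : ∀ m, K m ⊆ Eᶜ := by
    rintro m x (rfl | ⟨y, -, rfl⟩)
    · exact hpt
    · exact y.2
  have hstep : ∀ m, ∃ N : ℕ, ∀ n > N, ∃ φ : X.carrier → (T n).carrier, ContinuousOn φ (K m) ∧
      InjOn φ (K m) ∧ φ X.pt = (T n).pt ∧ ∀ x ∈ K m, (T n).proj (φ x) = X.proj x := by
    intro m
    obtain ⟨N, hN⟩ := h (K m) (hK m) (hKE m) (mem_insert _ _)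
    refine ⟨N, fun n hn => ?_⟩
    obtain ⟨φ, hφ, hφpt, hφl⟩ := hN n hn
    classical
    have heq : ∀ x : K m, (fun x => if hx : x ∈ K m then φ ⟨x, hx⟩ else (T n).pt) x = φ x :=
      fun x => dif_pos x.2
    refine ⟨fun x => if hx : x ∈ K m then φ ⟨x, hx⟩ else (T n).pt, ?_, ?_, ?_, ?_⟩
    · rw [continuousOn_iff_continuous_domRestrict]
      exact hφ.continuous.congr fun x => (heq x).symm
    · intro x hx y hy hxy
      rw [heq ⟨x, hx⟩, heq ⟨y, hy⟩] at hxy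
      exact congrArg Subtype.val (hφ.injective hxy)
    · exact (heq ⟨X.pt, mem_insert _ _⟩).trans hφpt
    · exact fun x hx => (congrArg _ (heq ⟨x, hx⟩)).trans (hφl ⟨x, hx⟩)
  choose N hN using hstep
  have hstep' : ∀ m n, ∃ φ : X.carrier → (T n).carrier, N m < n → ContinuousOn φ (K m) ∧
      InjOn φ (K m) ∧ φ X.pt = (T n).pt ∧ ∀ x ∈ K m, (T n).proj (φ x) = X.proj x := by
    intro m n
    by_cases hn : N m < n
    · obtain ⟨φ, hφ⟩ := hN m n hn
      exact ⟨φ, fun _ => hφ⟩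
    · exact ⟨fun _ => (T n).pt, fun h => absurd h hn⟩
  choose φ hφ using hstep'
  let M : ℕ → ℕ := fun n => Nat.findGreatest (fun m => N m < n) n
  have hM : ∀ n, N 0 < n → N (M n) < n := fun n hn =>
    Nat.findGreatest_spec (P := fun m => N m < n) (Nat.zero_le n) hn
  refine ⟨E, fun n => φ (M n) n, hE, hEd, hpt, ?_, ?_⟩
  · filter_upwards [eventually_gt_atTop (N 0)] with n hn
    exact (hφ _ n (hM n hn)).2.2.1
  · intro L hL hLE
    have hL' : IsCompact (Subtype.val ⁻¹' L : Set (Eᶜ : Set X.carrier)) :=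
      IsInducing.subtypeVal.isCompact_preimage' hL (by rwa [Subtype.range_coe])
    obtain ⟨m, hm⟩ := κ.exists_superset_of_isCompact hL'
    filter_upwards [eventually_gt_atTop (N 0), eventually_gt_atTop (N m), eventually_ge_atTop m]
      with n h0 hnm hmn
    have hmM : m ≤ M n := Nat.le_findGreatest hmn hnm
    have hLK : L ⊆ K (M n) := fun x hx =>
      Or.inr ⟨⟨x, hLE hx⟩, κ.subset hmM (hm hx), rfl⟩
    obtain ⟨h1, h2, -, h4⟩ := hφ _ n (hM n h0)
    exact ⟨h1.mono hLK, h2.mono hLK, fun x hx => h4 x (hLK hx)⟩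

/-- The sequences of images of `x` and of `y` eventually coincide. -/
def EventuallyMeet {T : ℕ → PointedSurface.{u}} {X Y : PointedSurface.{u}}
    (φ : ∀ n, X.carrier → (T n).carrier) (ψ : ∀ n, Y.carrier → (T n).carrier) (x : X.carrier)
    (y : Y.carrier) : Prop :=
  ∀ᶠ n in atTop, φ n x = ψ n y

theorem LocInj.apply_of_injOn {X Y : SpreadSurface.{u}} {φ : X.carrier → Y.carrier}
    {M : Set X.carrier} {x : X.carrier} (hx : LocInj X.proj x) (hM : M ∈ 𝓝 x)
    (hc : ContinuousOn φ M) (hi : InjOn φ M) (hl : ∀ x ∈ M, Y.proj (φ x) = X.proj x) :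
    LocInj Y.proj (φ x) := by
  obtain ⟨U, hU, hUi⟩ := hx
  refine ⟨_, X.locallyPlanar.image_mem_nhds Y.locallyPlanar (inter_mem hU hM)
    (hc.mono inter_subset_right) (hi.mono inter_subset_right), ?_⟩
  rintro _ ⟨a, ha, rfl⟩ _ ⟨b, hb, rfl⟩ hab
  rw [hl a ha.2, hl b hb.2] at hab
  rw [hUi ha.1 hb.1 hab]

namespace IsLimitMap

variable {T : ℕ → PointedSurface.{u}} {X Y : PointedSurface.{u}} {E : Set X.carrier}
  {F : Set Y.carrier} {φ : ∀ n, X.carrier → (T n).carrier} {ψ : ∀ n, Y.carrier → (T n).carrier}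

theorem eq_of_frequently (hφ : IsLimitMap T X E φ) {x x' : X.carrier} (hx : x ∉ E) (hx' : x' ∉ E)
    (h : ∃ᶠ n in atTop, φ n x = φ n x') : x = x' := by
  have hK : ({x, x'} : Set X.carrier) ⊆ Eᶜ := by
    rintro z (rfl | rfl)
    · exact hx
    · exact hx'
  obtain ⟨n, h1, -, h2, -⟩ := (h.and_eventually
    (hφ.eventually {x, x'} (Set.toFinite _).isCompact hK)).exists
  exact h2 (mem_insert _ _) (mem_insert_of_mem _ rfl) h1

/-- Along a connected set `B` of points of `Y`, the images under `ψ n` and under `φ n ∘ σ`, where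
`σ` is a section into `X`, agree everywhere or nowhere, for all large `n`. -/
theorem eventually_all_or_none (hφ : IsLimitMap T X E φ) (hψ : IsLimitMap T Y F ψ)
    {D : Set RSphere} {σ : RSphere → X.carrier} (hσ : IsSection X.proj D σ)
    (hi : ∀ q ∈ D, LocInj X.proj (σ q)) {B : Set Y.carrier} (hB : IsOpen B)
    (hBc : IsPreconnected B) (hBcpt : IsCompact (closure B)) (hBF : closure B ⊆ Fᶜ)
    (hBD : ∀ y ∈ closure B, Y.proj y ∈ D) (hBE : ∀ y ∈ closure B, σ (Y.proj y) ∉ E) :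
    ∀ᶠ n in atTop, (∀ y ∈ B, φ n (σ (Y.proj y)) = ψ n y) ∨
      ∀ y ∈ B, φ n (σ (Y.proj y)) ≠ ψ n y := by
  have hσc : ContinuousOn (fun y => σ (Y.proj y)) (closure B) :=
    hσ.continuousOn.comp Y.continuous_proj.continuousOn hBD
  have hKE : (fun y => σ (Y.proj y)) '' closure B ⊆ Eᶜ := by
    rintro _ ⟨y, hy, rfl⟩
    exact hBE y hy
  have hMo : IsOpen (σ '' (Y.proj '' B)) := by
    refine hσ.isOpen_image X.continuous_proj hi (Y.isOpenMap_proj _ hB) ?_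
    rintro _ ⟨y, hy, rfl⟩
    exact hBD y (subset_closure hy)
  have hMK : σ '' (Y.proj '' B) ⊆ (fun y => σ (Y.proj y)) '' closure B := by
    rintro _ ⟨_, ⟨y, hy, rfl⟩, rfl⟩
    exact ⟨y, subset_closure hy, rfl⟩
  filter_upwards [hφ.eventually _ (hBcpt.image_of_continuousOn hσc) hKE,
    hψ.eventually _ hBcpt hBF] with n ⟨h1, h2, h3⟩ ⟨h4, h5, h6⟩
  by_cases hex : ∃ y ∈ B, φ n (σ (Y.proj y)) = ψ n y
  · left
    obtain ⟨a, ha, hae⟩ := hex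
    have heq : EqOn (ψ n) (fun y => φ n (σ (Y.proj y))) B := by
      refine eqOn_of_lifts (f := (T n).proj) hBc (h4.mono subset_closure) ?_ ?_ ?_ ha hae.symm
      · exact h1.comp (hσc.mono subset_closure) fun y hy => ⟨y, subset_closure hy, rfl⟩
      · intro y hy
        rw [h6 y (subset_closure hy), h3 _ ⟨y, subset_closure hy, rfl⟩,
          hσ.apply_eq _ (hBD y (subset_closure hy))]
      · intro y hy
        exact (hi _ (hBD y (subset_closure hy))).apply_of_injOn (X := X.toSpreadSurface)
          (Y := (T n).toSpreadSurface)
          (hMo.mem_nhds ⟨_, ⟨y, hy, rfl⟩, rfl⟩) (h1.mono hMK) (h2.mono hMK)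
          fun x hx => h3 x (hMK hx)
    exact fun y hy => (heq hy).symm
  · right
    exact fun y hy h => hex ⟨y, hy, h⟩

theorem preimage_section_mem_nhdsNE (hφ : IsLimitMap T X E φ) {D : Set RSphere} (hD : IsOpen D)
    {σ : RSphere → X.carrier} (hσ : IsSection X.proj D σ) {y : Y.carrier} (hy : Y.proj y ∈ D) :
    {z | σ (Y.proj z) ∉ E} ∈ 𝓝[≠] y := by
  refine preimage_compl_mem_nhdsNE (h := fun z => σ (Y.proj z)) ?_
    (hφ.isDiscrete.compl_mem_nhdsNE hφ.isClosed _) ?_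
  · exact ContinuousAt.comp (hσ.continuousOn.continuousAt (hD.mem_nhds hy))
      Y.continuous_proj.continuousAt
  · filter_upwards [Y.eventually_proj_ne y, nhdsWithin_le_nhds
      (Y.continuous_proj.continuousAt.preimage_mem_nhds (hD.mem_nhds hy))] with z hz hzD h
    have := congrArg X.proj h
    simp only [hσ.apply_eq _ hzD, hσ.apply_eq _ hy] at this
    exact hz this

/-- Eventual coincidence propagates along a connected open set. -/
theorem eventuallyMeet_of_section (hφ : IsLimitMap T X E φ) (hψ : IsLimitMap T Y F ψ)
    {D : Set RSphere} (hD : IsOpen D) {σ : RSphere → X.carrier} (hσ : IsSection X.proj D σ)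
    (hi : ∀ q ∈ D, LocInj X.proj (σ q)) {N : Set Y.carrier} (hN : IsOpen N)
    (hNc : IsPreconnected N) (hNF : N ⊆ Fᶜ) (hND : ∀ y ∈ N, Y.proj y ∈ D) {a : Y.carrier}
    (haN : a ∈ N) (haE : σ (Y.proj a) ∉ E) (ha : EventuallyMeet φ ψ (σ (Y.proj a)) a) :
    ∀ y ∈ N, σ (Y.proj y) ∉ E → EventuallyMeet φ ψ (σ (Y.proj y)) y := by
  have hNG : IsPreconnected (N ∩ {z | σ (Y.proj z) ∉ E}) :=
    Y.locallyPlanar.isPreconnected_inter hN hNc fun y hy =>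
      hφ.preimage_section_mem_nhdsNE hD hσ (hND y hy)
  have hσc : ContinuousOn (fun y => σ (Y.proj y)) N :=
    hσ.continuousOn.comp Y.continuous_proj.continuousOn hND
  have hopen : IsOpen (N ∩ {z | σ (Y.proj z) ∉ E}) :=
    hσc.isOpen_inter_preimage hN hφ.isClosed.isOpen_compl
  have hloc : ∀ y ∈ N ∩ {z | σ (Y.proj z) ∉ E}, ∃ B, IsOpen B ∧ y ∈ B ∧ ∀ z ∈ B,
      (EventuallyMeet φ ψ (σ (Y.proj z)) z ↔ EventuallyMeet φ ψ (σ (Y.proj y)) y) := by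
    intro y hy
    obtain ⟨B, hB, hyB, hBc, -, hBcpt, hBV⟩ := Y.locallyPlanar.exists_nhds_isPreconnected
      (hopen.mem_nhds hy)
    have := hφ.eventually_all_or_none hψ hσ hi hB hBc hBcpt
      (fun z hz => hNF (hBV hz).1) (fun z hz => hND z (hBV hz).1) fun z hz => (hBV hz).2
    refine ⟨B, hB, hyB, fun z hz => ?_⟩
    refine eventually_congr ?_
    filter_upwards [this] with n hn
    rcases hn with h | h
    · simp [h z hz, h y hyB]
    · simp [h z hz, h y hyB]
  have hopen' : ∀ P : Prop → Prop, IsOpen {y | y ∈ N ∩ {z | σ (Y.proj z) ∉ E} ∧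
      P (EventuallyMeet φ ψ (σ (Y.proj y)) y)} := by
    intro P
    rw [isOpen_iff_mem_nhds]
    rintro y ⟨hy, hP⟩
    obtain ⟨B, hB, hyB, hBy⟩ := hloc y hy
    filter_upwards [hopen.mem_nhds hy, hB.mem_nhds hyB] with z hz hzB
    exact ⟨hz, by rwa [propext (hBy z hzB)]⟩
  intro y hyN hyE
  by_contra hy
  obtain ⟨z, -, hz, hz'⟩ := hNG _ _ (hopen' id) (hopen' Not)
    (fun z hz => (em (EventuallyMeet φ ψ (σ (Y.proj z)) z)).imp (fun h => ⟨hz, h⟩)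
      fun h => ⟨hz, h⟩) ⟨a, ⟨haN, haE⟩, ⟨haN, haE⟩, ha⟩ ⟨y, ⟨hyN, hyE⟩, ⟨hyN, hyE⟩, hy⟩
  exact hz'.2 hz.2

end IsLimitMap

/-! ### The correspondence between two surfaces that embed into the same sequence -/

/-- Over the open set `N` of `Y`, eventual coincidence of images is described by the section `σ`
of the projection of `X`. -/
structure LocalMatch {T : ℕ → PointedSurface.{u}} {X Y : PointedSurface.{u}} (E : Set X.carrier)
    (φ : ∀ n, X.carrier → (T n).carrier) (ψ : ∀ n, Y.carrier → (T n).carrier) (N : Set Y.carrier)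
    (D : Set RSphere) (σ : RSphere → X.carrier) : Prop where
  isOpen : IsOpen N
  isOpen_base : IsOpen D
  isSection : IsSection X.proj D σ
  locInj : ∀ q ∈ D, LocInj X.proj (σ q)
  mapsTo : ∀ y ∈ N, Y.proj y ∈ D
  meet : ∀ y ∈ N, σ (Y.proj y) ∉ E → EventuallyMeet φ ψ (σ (Y.proj y)) y

section Match

variable {T : ℕ → PointedSurface.{u}} {X Y : PointedSurface.{u}} {E : Set X.carrier}
  {F : Set Y.carrier} {φ : ∀ n, X.carrier → (T n).carrier} {ψ : ∀ n, Y.carrier → (T n).carrier}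
  {N N' : Set Y.carrier} {D D' : Set RSphere} {σ σ' : RSphere → X.carrier}

theorem LocalMatch.continuousOn (h : LocalMatch E φ ψ N D σ) :
    ContinuousOn (fun y => σ (Y.proj y)) N :=
  h.isSection.continuousOn.comp Y.continuous_proj.continuousOn h.mapsTo

theorem LocalMatch.eq_of_mem (hφ : IsLimitMap T X E φ) (h : LocalMatch E φ ψ N D σ)
    (h' : LocalMatch E φ ψ N' D' σ') {y : Y.carrier} (hy : y ∈ N) (hy' : y ∈ N') :
    σ (Y.proj y) = σ' (Y.proj y) := by
  have := Y.locallyPlanar.nhdsNE_neBot y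
  refine tendsto_nhds_unique
    ((h.continuousOn.continuousAt (h.isOpen.mem_nhds hy)).mono_left nhdsWithin_le_nhds :
      Tendsto _ (𝓝[≠] y) _)
    (((h'.continuousOn.continuousAt (h'.isOpen.mem_nhds hy')).mono_left nhdsWithin_le_nhds :
      Tendsto _ (𝓝[≠] y) _).congr' ?_)
  filter_upwards [hφ.preimage_section_mem_nhdsNE h.isOpen_base h.isSection (h.mapsTo y hy),
    hφ.preimage_section_mem_nhdsNE h'.isOpen_base h'.isSection (h'.mapsTo y hy'),
    nhdsWithin_le_nhds (h.isOpen.mem_nhds hy), nhdsWithin_le_nhds (h'.isOpen.mem_nhds hy')]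
    with z hz hz' hzN hzN'
  refine hφ.eq_of_frequently hz' hz (Eventually.frequently ?_)
  filter_upwards [h.meet z hzN hz, h'.meet z hzN' hz'] with n hn hn'
  rw [hn, hn']

theorem LocalMatch.injective (hφ : IsLimitMap T X E φ) (hψ : IsLimitMap T Y F ψ)
    (h : LocalMatch E φ ψ N D σ) (h' : LocalMatch E φ ψ N' D' σ') (hNF : N ⊆ Fᶜ) (hNF' : N' ⊆ Fᶜ)
    {y y' : Y.carrier} (hy : y ∈ N) (hy' : y' ∈ N') (hyy' : σ (Y.proj y) = σ' (Y.proj y')) :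
    y = y' := by
  by_contra hne
  obtain ⟨V, V', hV, hV', hyV, hyV', hVV'⟩ := t2_separation hne
  have hopen : ∀ {N V : Set Y.carrier} {D σ} {y}, LocalMatch E φ ψ N D σ → IsOpen V → y ∈ N →
      y ∈ V → σ '' (Y.proj '' (N ∩ V)) ∈ 𝓝 (σ (Y.proj y)) := by
    intro N V D σ y h hV hy hyV
    refine (h.isSection.isOpen_image X.continuous_proj h.locInj
      (Y.isOpenMap_proj _ (h.isOpen.inter hV)) ?_).mem_nhds ⟨_, ⟨y, ⟨hy, hyV⟩, rfl⟩, rfl⟩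
    rintro _ ⟨z, hz, rfl⟩
    exact h.mapsTo z hz.1
  have h1 := hopen h hV hy hyV
  have h2 := hopen h' hV' hy' hyV'
  rw [← hyy'] at h2
  have := X.locallyPlanar.nhdsNE_neBot (σ (Y.proj y))
  obtain ⟨x, hxE, ⟨_, ⟨a, ha, rfl⟩, hax⟩, _, ⟨b, hb, rfl⟩, hbx⟩ := Filter.nonempty_of_mem
    (inter_mem (hφ.isDiscrete.compl_mem_nhdsNE hφ.isClosed (σ (Y.proj y)))
      (nhdsWithin_le_nhds (inter_mem h1 h2)))
  have hab : a = b := by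
    refine hψ.eq_of_frequently (hNF ha.1) (hNF' hb.1) (Eventually.frequently ?_)
    filter_upwards [h.meet a ha.1 (by rwa [hax]), h'.meet b hb.1 (by rwa [hbx])] with n hn hn'
    rw [← hn, ← hn', hax, hbx]
  exact disjoint_left.1 hVV' ha.2 (hab ▸ hb.2)

/-- Near the marked points the surfaces match, because one disk lifts to all `T n`. -/
theorem exists_disk_sections (hT : HasCommonDisk T) (hφ : IsLimitMap T X E φ)
    (hψ : IsLimitMap T Y F ψ) :
    ∃ (D : Set RSphere) (σ : RSphere → X.carrier) (τ : RSphere → Y.carrier) (O : Set Y.carrier),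
      IsOpen D ∧ X.proj X.pt ∈ D ∧ IsSection X.proj D σ ∧ IsSection Y.proj D τ ∧
      σ (X.proj X.pt) = X.pt ∧ τ (X.proj X.pt) = Y.pt ∧ (∀ q ∈ D, LocInj X.proj (σ q)) ∧
      IsOpen O ∧ Y.pt ∈ O ∧ O ⊆ Fᶜ ∧ (∀ y ∈ O, Y.proj y ∈ D ∧ τ (Y.proj y) = y) ∧
      ∀ q ∈ D, EventuallyMeet φ ψ (σ q) (τ q) := by
  obtain ⟨p, r, -, hp⟩ := hT
  have hbase : ∀ {X : PointedSurface.{u}} {E φ}, IsLimitMap T X E φ → X.proj X.pt = p := by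
    intro X E φ hφ
    obtain ⟨n, h1, -, -, h2⟩ := (hφ.eventually_pt.and (hφ.eventually {X.pt} isCompact_singleton
      (singleton_subset_iff.2 hφ.pt_notMem))).exists
    rw [← h2 _ rfl, h1, (hp n).1]
  have hXp := hbase hφ
  have hYp := hbase hψ
  have hball : sphericalBall p r ∈ 𝓝 p := by
    obtain ⟨h0, W, hW, -, hpt, e, he⟩ := hp 0
    have h1 : (T 0).proj '' W = sphericalBall p r := by
      ext q
      constructor
      · rintro ⟨w, hw, rfl⟩
        rw [← he ⟨w, hw⟩]
        exact (e ⟨w, hw⟩).2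
      · intro hq
        refine ⟨e.symm ⟨q, hq⟩, (e.symm ⟨q, hq⟩).2, ?_⟩
        rw [← he, e.apply_symm_apply]
    rw [← h1, ← h0]
    exact ((T 0).isOpenMap_proj W hW).mem_nhds ⟨_, hpt, rfl⟩
  -- neighbourhoods of the marked points on which the projections and the limit maps are injective
  have hnice : ∀ {X : PointedSurface.{u}} {E φ}, IsLimitMap T X E φ → ∃ O, IsOpen O ∧ X.pt ∈ O ∧
      IsCompact (closure O) ∧ closure O ⊆ Eᶜ ∧ InjOn X.proj O := by
    intro X E φ hφ
    obtain ⟨U, hU, hUi⟩ := locInj_of_not_isCriticalPoint X.not_critical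
    obtain ⟨O, hO, hx, -, -, hc, hOV⟩ := X.locallyPlanar.exists_nhds_isPreconnected
      (inter_mem hU (hφ.isClosed.isOpen_compl.mem_nhds hφ.pt_notMem))
    exact ⟨O, hO, hx, hc, fun z hz => (hOV hz).2,
      hUi.mono fun z hz => (hOV (subset_closure hz)).1⟩
  obtain ⟨O, hO, hXO, hOc, hOE, hOi⟩ := hnice hφ
  obtain ⟨O', hO', hYO', hOc', hOF, hOi'⟩ := hnice hψ
  have : Nonempty X.carrier := ⟨X.pt⟩
  have : Nonempty Y.carrier := ⟨Y.pt⟩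
  obtain ⟨σ, hσ, hσ'⟩ := exists_isSection_of_injOn X.isOpenMap_proj hO hOi
  obtain ⟨τ, hτ, hτ'⟩ := exists_isSection_of_injOn Y.isOpenMap_proj hO' hOi'
  obtain ⟨c, hc, hpc, hcV⟩ := exists_isOpenEmbedding_range_subset (inter_mem hball (inter_mem
    ((X.isOpenMap_proj O hO).mem_nhds ⟨_, hXO, hXp⟩)
    ((Y.isOpenMap_proj O' hO').mem_nhds ⟨_, hYO', hYp⟩)))
  have hσO : ∀ q ∈ range c, σ q ∈ O := by
    intro q hq
    obtain ⟨x, hx, rfl⟩ := (hcV hq).2.1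
    rwa [hσ' x hx]
  have hτO : ∀ q ∈ range c, τ q ∈ O' := by
    intro q hq
    obtain ⟨y, hy, rfl⟩ := (hcV hq).2.2
    rwa [hτ' y hy]
  have hσD : IsSection X.proj (range c) σ :=
    ⟨hσ.continuousOn.mono fun q hq => (hcV hq).2.1, fun q hq => hσ.apply_eq q (hcV hq).2.1⟩
  have hτD : IsSection Y.proj (range c) τ :=
    ⟨hτ.continuousOn.mono fun q hq => (hcV hq).2.2, fun q hq => hτ.apply_eq q (hcV hq).2.2⟩
  have hσp : σ p = X.pt := by rw [← hXp, hσ' _ hXO]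
  have hτp : τ p = Y.pt := by rw [← hYp, hτ' _ hYO']
  refine ⟨range c, σ, τ, O' ∩ Y.proj ⁻¹' range c, hc.isOpen_range, hXp ▸ hpc, hσD, hτD,
    by rw [hXp, hσp], by rw [hXp, hτp], fun q hq => ⟨O, hO.mem_nhds (hσO q hq), hOi⟩,
    hO'.inter (hc.isOpen_range.preimage Y.continuous_proj), ⟨hYO', by rwa [mem_preimage, hYp]⟩,
    fun z hz => hOF (subset_closure hz.1), fun y hy => ⟨hy.2, hτ' y hy.1⟩, fun q hq => ?_⟩
  -- both images of the disk are the lift `s` of the common disk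
  have key : ∀ {X : PointedSurface.{u}} {E : Set X.carrier} {φ O σ}, IsLimitMap T X E φ →
      IsCompact (closure O) → closure O ⊆ Eᶜ → IsSection X.proj (range c) σ →
      (∀ q ∈ range c, σ q ∈ O) → σ p = X.pt → ∀ᶠ n in atTop, ∀ s : RSphere → (T n).carrier,
      ContinuousOn s (range c) → (∀ q ∈ range c, LocInj (T n).proj (s q) ∧ (T n).proj (s q) = q) →
      s p = (T n).pt → EqOn (fun q => φ n (σ q)) s (range c) := by
    intro X E φ O σ hφ hOc hOE hσ hσO hσp
    filter_upwards [hφ.eventually _ hOc hOE, hφ.eventually_pt] with n ⟨h1, _, h3⟩ h4 s hs hsi hsp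
    refine eqOn_of_lifts (f := (T n).proj) (isPreconnected_range hc.continuous) ?_ hs ?_
      (fun q hq => (hsi q hq).1) hpc (by rw [hσp, h4, hsp])
    · exact h1.comp hσ.continuousOn fun q hq => subset_closure (hσO q hq)
    · intro q hq
      rw [h3 _ (subset_closure (hσO q hq)), hσ.apply_eq q hq, (hsi q hq).2]
  filter_upwards [key hφ hOc hOE hσD hσO hσp, key hψ hOc' hOF hτD hτO hτp] with n h1 h2
  obtain ⟨h0, W, hW, -, hpt, e, he⟩ := hp n
  have : Nonempty (T n).carrier := ⟨(T n).pt⟩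
  have hWi : InjOn (T n).proj W := by
    intro a ha b hb hab
    have : e ⟨a, ha⟩ = e ⟨b, hb⟩ := Subtype.ext (by rw [he, he]; exact hab)
    exact congrArg Subtype.val (e.injective this)
  obtain ⟨s, hs, hs'⟩ := exists_isSection_of_injOn (T n).isOpenMap_proj hW hWi
  have hcW : range c ⊆ (T n).proj '' W := by
    intro q hq
    refine ⟨e.symm ⟨q, (hcV hq).1⟩, (e.symm ⟨q, (hcV hq).1⟩).2, ?_⟩
    rw [← he, e.apply_symm_apply]
  have hsp : s p = (T n).pt := by rw [← h0, hs' _ hpt]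
  have hsi : ∀ q ∈ range c, LocInj (T n).proj (s q) ∧ (T n).proj (s q) = q := by
    intro q hq
    refine ⟨⟨W, hW.mem_nhds ?_, hWi⟩, hs.apply_eq q (hcW hq)⟩
    obtain ⟨w, hw, rfl⟩ := hcW hq
    rwa [hs' w hw]
  exact (h1 s (hs.continuousOn.mono hcW) hsi hsp hq).trans
    (h2 s (hs.continuousOn.mono hcW) hsi hsp hq).symm

theorem isDiscrete_union {S : Type*} [TopologicalSpace S] {A B : Set S} (hA : IsClosed A)
    (hB : IsClosed B) (hA' : IsDiscrete A) (hB' : IsDiscrete B) : IsDiscrete (A ∪ B) := by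
  rw [isDiscrete_iff_nhdsNE]
  intro x _
  have := inter_mem (hA'.compl_mem_nhdsNE hA x) (hB'.compl_mem_nhdsNE hB x)
  rw [← compl_union] at this
  exact disjoint_iff.1 (disjoint_principal_right.2 this)

theorem SpreadSurface.isDiscrete_preimage (X : SpreadSurface.{u}) {Q : Set RSphere}
    (hQ : Q.Finite) : IsDiscrete (X.proj ⁻¹' Q) :=
  hQ.isDiscrete.preimage' X.continuous_proj.continuousOn X.discrete_proj

/-- Off the exceptional set of `Y` and the fibres of the singular values of `X`, all of `Y` is
matched with `X`: the set of matched points is open and closed. -/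
theorem exists_localMatch (hT : HasCommonDisk T) (hX : X.toSpreadSurface.IsSpeiser)
    (hφ : IsLimitMap T X E φ) (hψ : IsLimitMap T Y F ψ) {y : Y.carrier}
    (hy : y ∉ F ∪ Y.proj ⁻¹' X.singularValues) :
    ∃ N D σ, LocalMatch E φ ψ N D σ ∧ N ⊆ (F ∪ Y.proj ⁻¹' X.singularValues)ᶜ ∧ y ∈ N := by
  set F' := F ∪ Y.proj ⁻¹' X.singularValues with hF'
  have hQ : IsClosed X.singularValues := Set.Finite.isClosed hX
  have hF'c : IsClosed F' := hψ.isClosed.union (hQ.preimage Y.continuous_proj)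
  have hF'd : IsDiscrete F' := isDiscrete_union hψ.isClosed (hQ.preimage Y.continuous_proj)
    hψ.isDiscrete (Y.isDiscrete_preimage hX)
  have hconn : IsPreconnected F'ᶜ := by
    have := Y.locallyPlanar.isPreconnected_inter isOpen_univ isPreconnected_univ
      (fun y _ => hF'd.compl_mem_nhdsNE hF'c y)
    rwa [univ_inter] at this
  set A : Set Y.carrier := {y | ∃ N D σ, LocalMatch E φ ψ N D σ ∧ N ⊆ F'ᶜ ∧ y ∈ N} with hA
  have hAo : IsOpen A := by
    rw [isOpen_iff_mem_nhds]
    rintro y ⟨N, D, σ, h, hN, hy⟩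
    filter_upwards [h.isOpen.mem_nhds hy] with z hz
    exact ⟨N, D, σ, h, hN, hz⟩
  -- a small connected neighbourhood that contains one matched point consists of matched points
  have hstep : ∀ y ∉ F', ∃ N ∈ 𝓝 y, (N ∩ A).Nonempty → N ⊆ A := by
    intro y hy
    obtain ⟨D, hD, hyD, -, hDQ, hDσ⟩ := X.exists_regular_nhds hQ (q := Y.proj y)
      fun h => hy (Or.inr h)
    obtain ⟨N, hN, hyN, hNc, -, -, hNV⟩ := Y.locallyPlanar.exists_nhds_isPreconnected
      (inter_mem (hF'c.isOpen_compl.mem_nhds hy)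
        (Y.continuous_proj.continuousAt.preimage_mem_nhds (hD.mem_nhds hyD)))
    replace hNV := subset_closure.trans hNV
    refine ⟨N, hN.mem_nhds hyN, ?_⟩
    rintro ⟨a, haN, N₁, D₁, σ₁, h₁, -, haN₁⟩ z hz
    have := Y.locallyPlanar.nhdsNE_neBot a
    obtain ⟨b, hbE, hbN, hbN₁⟩ := Filter.nonempty_of_mem (inter_mem
      (hφ.preimage_section_mem_nhdsNE h₁.isOpen_base h₁.isSection (h₁.mapsTo a haN₁))
      (nhdsWithin_le_nhds (inter_mem (hN.mem_nhds haN) (h₁.isOpen.mem_nhds haN₁))))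
    have hfb := h₁.isSection.apply_eq _ (h₁.mapsTo b hbN₁)
    obtain ⟨σ, hσ, hσb⟩ := hDσ (σ₁ (Y.proj b)) (by rw [hfb]; exact (hNV hbN).2)
    rw [hfb] at hσb
    have hi : ∀ q ∈ D, LocInj X.proj (σ q) := fun q hq =>
      X.locInj_of_notMem_singularValues (by rw [hσ.apply_eq q hq]; exact hDQ hq)
    refine ⟨N, D, σ, ⟨hN, hD, hσ, hi, fun z hz => (hNV hz).2, ?_⟩, fun z hz => (hNV hz).1, hz⟩
    exact hφ.eventuallyMeet_of_section hψ hD hσ hi hN hNc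
      (fun z hz h => (hNV hz).1 (Or.inl h)) (fun z hz => (hNV hz).2) hbN (by rwa [hσb])
      (by rw [hσb]; exact h₁.meet b hbN₁ hbE)
  have hne : (F'ᶜ ∩ A).Nonempty := by
    obtain ⟨D, σ, τ, O, hD, -, hσ, -, -, -, hi, hO, hYO, hOF, hOτ, hmeet⟩ :=
      exists_disk_sections hT hφ hψ
    have := Y.locallyPlanar.nhdsNE_neBot Y.pt
    obtain ⟨z, hzF, hzO⟩ := Filter.nonempty_of_mem (inter_mem
      (hF'd.compl_mem_nhdsNE hF'c Y.pt) (nhdsWithin_le_nhds (hO.mem_nhds hYO)))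
    refine ⟨z, hzF, O ∩ F'ᶜ, D, σ, ⟨hO.inter hF'c.isOpen_compl, hD, hσ, hi,
      fun y hy => (hOτ y hy.1).1, fun y hy _ => ?_⟩, inter_subset_right, hzO, hzF⟩
    have := hmeet _ (hOτ y hy.1).1
    rwa [(hOτ y hy.1).2] at this
  have hB : IsOpen {y | y ∉ F' ∧ y ∉ A} := by
    rw [isOpen_iff_mem_nhds]
    rintro y ⟨hy, hyA⟩
    obtain ⟨N, hN, hNA⟩ := hstep y hy
    filter_upwards [hN, hF'c.isOpen_compl.mem_nhds hy] with z hz hzF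
    exact ⟨hzF, fun hzA => hyA (hNA ⟨z, hz, hzA⟩ (mem_of_mem_nhds hN))⟩
  have hsub : F'ᶜ ⊆ A := hconn.subset_left_of_subset_union hAo hB
    (disjoint_left.2 fun z hz hz' => hz'.2 hz)
    (fun z hz => (em (z ∈ A)).imp id fun h => ⟨hz, h⟩) hne
  exact hsub hy

/-- The matching map, defined off the exceptional set of `Y` and the fibres of the singular
values of `X`. -/
theorem exists_matching (hT : HasCommonDisk T) (hX : X.toSpreadSurface.IsSpeiser)
    (hφ : IsLimitMap T X E φ) (hψ : IsLimitMap T Y F ψ) :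
    ∃ g : Y.carrier → X.carrier,
      ContinuousOn g (F ∪ Y.proj ⁻¹' X.singularValues)ᶜ ∧
      InjOn g (F ∪ Y.proj ⁻¹' X.singularValues)ᶜ ∧
      (∀ y ∉ F ∪ Y.proj ⁻¹' X.singularValues, X.proj (g y) = Y.proj y) ∧
      (∀ y ∉ F ∪ Y.proj ⁻¹' X.singularValues, g y ∉ E → EventuallyMeet φ ψ (g y) y) ∧
      (X.pt, Y.pt) ∈ closureGraph (F ∪ Y.proj ⁻¹' X.singularValues) g := by
  have : Nonempty X.carrier := ⟨X.pt⟩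
  choose! N D σ hm hNF hN using fun y hy =>
    exists_localMatch (y := y) hT hX hφ hψ hy
  have hgσ : ∀ y ∉ F ∪ Y.proj ⁻¹' X.singularValues, ∀ z ∈ N y,
      σ z (Y.proj z) = σ y (Y.proj z) := fun y hy z hz =>
    (hm z (hNF y hy hz)).eq_of_mem hφ (hm y hy) (hN z (hNF y hy hz)) hz
  refine ⟨fun y => σ y (Y.proj y), ?_, ?_, ?_, ?_, ?_⟩
  · intro y hy
    refine ContinuousAt.continuousWithinAt ?_
    refine ((hm y hy).continuousOn.continuousAt ((hm y hy).isOpen.mem_nhds (hN y hy))).congr ?_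
    filter_upwards [(hm y hy).isOpen.mem_nhds (hN y hy)] with z hz
    exact (hgσ y hy z hz).symm
  · intro y hy y' hy' h
    exact (hm y hy).injective hφ hψ (hm y' hy') (fun z hz h => hNF y hy hz (Or.inl h))
      (fun z hz h => hNF y' hy' hz (Or.inl h)) (hN y hy) (hN y' hy') h
  · exact fun y hy => (hm y hy).isSection.apply_eq _ ((hm y hy).mapsTo y (hN y hy))
  · exact fun y hy hE => (hm y hy).meet y (hN y hy) hE
  · obtain ⟨D₀, σ₀, τ₀, O, hD₀, hpD₀, hσ₀, hτ₀, hσp, hτp, hi, hO, hYO, hOF, hOτ, hmeet⟩ :=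
      exists_disk_sections hT hφ hψ
    have hQ : IsClosed X.singularValues := Set.Finite.isClosed hX
    have hcl : IsClosed (F ∪ Y.proj ⁻¹' X.singularValues) :=
      hψ.isClosed.union (hQ.preimage Y.continuous_proj)
    have hd : IsDiscrete (F ∪ Y.proj ⁻¹' X.singularValues) :=
      isDiscrete_union hψ.isClosed (hQ.preimage Y.continuous_proj)
        hψ.isDiscrete (Y.isDiscrete_preimage hX)
    have hm₀ : LocalMatch E φ ψ O D₀ σ₀ := ⟨hO, hD₀, hσ₀, hi, fun y hy => (hOτ y hy).1,
      fun y hy _ => by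
        have := hmeet _ (hOτ y hy).1
        rwa [(hOτ y hy).2] at this⟩
    have hYp : Y.proj Y.pt = X.proj X.pt := by
      rw [← hτp, hτ₀.apply_eq _ hpD₀]
    have hY : σ₀ (Y.proj Y.pt) = X.pt := by rw [hYp, hσp]
    have := Y.locallyPlanar.nhdsNE_neBot Y.pt
    have ht : Tendsto (fun y => (σ₀ (Y.proj y), y)) (𝓝[≠] Y.pt) (𝓝 (X.pt, Y.pt)) := by
      have := ((hm₀.continuousOn.continuousAt (hO.mem_nhds hYO)).prodMk
        continuousAt_id).mono_left (nhdsWithin_le_nhds (s := {Y.pt}ᶜ))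
      simpa only [ContinuousAt, id, hY] using this
    refine mem_closure_of_tendsto ht ?_
    filter_upwards [hd.compl_mem_nhdsNE hcl Y.pt,
      nhdsWithin_le_nhds (hO.mem_nhds hYO)] with y hy hyO
    exact ⟨y, hy, Prod.ext ((hm y hy).eq_of_mem hφ hm₀ (hN y hy) hyO) rfl⟩

end Match

/-! ### Coincidence of limit maps near a pair of points -/

section Comparison

variable {T : ℕ → PointedSurface.{u}} {X Y : PointedSurface.{u}} {E : Set X.carrier}
  {F : Set Y.carrier} {φ : ∀ n, X.carrier → (T n).carrier} {ψ : ∀ n, Y.carrier → (T n).carrier}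
  {Γ : Set (X.carrier × Y.carrier)} {Q : Set RSphere}

theorem SpreadSurface.countable_preimage (X : SpreadSurface.{u}) {C : Set RSphere}
    (hC : C.Countable) : (X.proj ⁻¹' C).Countable := by
  have : X.proj ⁻¹' C = ⋃ c ∈ C, X.proj ⁻¹' {c} := by ext; simp
  rw [this]
  exact hC.biUnion fun c _ => (X.discrete_proj c).countable_of_secondCountable

/-- If the images of a small neighbourhood of `x` and of a small neighbourhood of `y` meet in
infinitely many `T n`, then the first image is contained in the second one for these `n`, and hence
some generic pair of nearby points is related. -/
theorem eventually_ne_of_notMem (hφ : IsLimitMap T X E φ) (hψ : IsLimitMap T Y F ψ)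
    (hΓ : IsGluing X.toSpreadSurface Y.toSpreadSurface Γ) (hQ : Q.Countable)
    (hmeet : ∀ x y, (x, y) ∈ Γ → x ∉ E → y ∉ F → X.proj x ∉ Q → EventuallyMeet φ ψ x y)
    (htot : ∀ y ∉ F, Y.proj y ∉ Q → ∃ x, (x, y) ∈ Γ) {x : X.carrier} {y : Y.carrier}
    (hx : x ∉ E) (hy : y ∉ F) (hxy : (x, y) ∉ Γ) (hq : X.proj x = Y.proj y) :
    ∀ᶠ p : ℕ × X.carrier × Y.carrier in atTop ×ˢ 𝓝 (x, y), φ p.1 p.2.1 ≠ ψ p.1 p.2.2 := by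
  obtain ⟨V, V', hV, hV', hxV, hyV', hVV'⟩ := isOpen_prod_iff.1 hΓ.isClosed.isOpen_compl x y hxy
  have hnb : V' ∩ (Fᶜ ∩ ((Y.proj ⁻¹' {Y.proj y})ᶜ ∪ {y})) ∈ 𝓝 y := by
    refine inter_mem (hV'.mem_nhds hyV') (inter_mem (hψ.isClosed.isOpen_compl.mem_nhds hy) ?_)
    rw [union_comm]
    exact insert_mem_nhds_iff.2 (Y.eventually_proj_ne y)
  obtain ⟨N, hN, hyN, -, -, hNc, hNV⟩ := Y.locallyPlanar.exists_nhds_isPreconnected hnb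
  have hD : IsOpen (Y.proj '' (closure N \ N))ᶜ :=
    ((hNc.diff hN).image Y.continuous_proj).isClosed.isOpen_compl
  have hqD : Y.proj y ∈ (Y.proj '' (closure N \ N))ᶜ := by
    rintro ⟨z, hz, hzq⟩
    exact ((hNV hz.1).2.2.resolve_right fun h => hz.2 (h ▸ hyN)) hzq
  obtain ⟨M, hM, hxM, hMc, -, hMcpt, hMV⟩ := X.locallyPlanar.exists_nhds_isPreconnected
    (inter_mem (hV.mem_nhds hxV) (inter_mem (hφ.isClosed.isOpen_compl.mem_nhds hx)
      ((hD.preimage X.continuous_proj).mem_nhds (by rwa [mem_preimage, hq]))))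
  suffices h : ∀ᶠ n in atTop, ∀ x' ∈ M, ∀ y' ∈ N, φ n x' ≠ ψ n y' by
    filter_upwards [h.prod_mk (prod_mem_nhds (hM.mem_nhds hxM) (hN.mem_nhds hyN))] with p hp
    exact hp.1 _ hp.2.1 _ hp.2.2
  by_contra hcon
  have hfreq : ∃ᶠ n in atTop, ∃ x' ∈ M, ∃ y' ∈ N, φ n x' = ψ n y' := by
    refine (not_eventually.1 hcon).mono fun n hn => ?_
    push Not at hn
    exact hn
  have hgood := (hφ.eventually _ hMcpt fun z hz => (hMV hz).2.1).and
    (hψ.eventually _ hNc fun z hz => (hNV hz).2.1)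
  have hsub : ∃ᶠ n in atTop, φ n '' M ⊆ ψ n '' N := by
    refine (hfreq.and_eventually hgood).mono ?_
    rintro n ⟨⟨x', hx', y', hy', hxy'⟩, ⟨h1, -, h3⟩, h4, h5, h6⟩
    have ho : IsOpen (ψ n '' N) := Y.locallyPlanar.isOpen_image (T n).locallyPlanar hN
      (h4.mono subset_closure) (h5.mono subset_closure)
    have hc : IsClosed (ψ n '' closure N) := (hNc.image_of_continuousOn h4).isClosed
    refine (hMc.image _ (h1.mono subset_closure)).subset_left_of_subset_union ho hc.isOpen_compl
      ?_ ?_ ⟨_, mem_image_of_mem _ hx', hxy' ▸ mem_image_of_mem _ hy'⟩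
    · exact disjoint_left.2 fun z hz hz' => hz' (image_mono subset_closure hz)
    · rintro _ ⟨z, hz, rfl⟩
      by_cases h : φ n z ∈ ψ n '' closure N
      · left
        obtain ⟨w, hw, hwz⟩ := h
        have hwN : w ∈ N := by
          by_contra hwN
          refine (hMV (subset_closure hz)).2.2 ⟨w, ⟨hw, hwN⟩, ?_⟩
          rw [← h6 w hw, hwz, h3 z (subset_closure hz)]
        exact ⟨w, hwN, hwz⟩
      · exact Or.inr h
  -- a point of `M` over a generic value
  have hC : (Q ∪ X.proj '' E).Countable :=
    hQ.union (hφ.isDiscrete.countable_of_secondCountable.image _)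
  obtain ⟨a, haM, haC⟩ := (X.locallyPlanar.dense_compl
    (X.countable_preimage hC)).inter_open_nonempty M hM ⟨x, hxM⟩
  have haQ : X.proj a ∉ Q := fun h => haC (Or.inl h)
  have hfin : (closure N ∩ Y.proj ⁻¹' {X.proj a}).Finite := by
    refine (hNc.inter_right (isClosed_singleton.preimage Y.continuous_proj)).finite ?_
    exact (Y.discrete_proj _).mono inter_subset_right
  have hb : ∃ b ∈ closure N ∩ Y.proj ⁻¹' {X.proj a}, b ∈ N ∧ ∃ᶠ n in atTop, φ n a = ψ n b := by
    by_contra! hb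
    have h1 : ∀ᶠ n in atTop, ∀ b ∈ closure N ∩ Y.proj ⁻¹' {X.proj a}, b ∈ N → φ n a ≠ ψ n b := by
      refine (eventually_all_finite hfin).2 fun b hb' => ?_
      by_cases hbN : b ∈ N
      · filter_upwards [hb b hb' hbN] with n hn _
        exact hn
      · exact Eventually.of_forall fun n h => absurd h hbN
    obtain ⟨n, hn, ⟨⟨-, -, h3⟩, -, -, h6⟩, h1⟩ := (hsub.and_eventually (hgood.and h1)).exists
    obtain ⟨b, hbN, hba⟩ := hn (mem_image_of_mem _ haM)
    refine h1 b ⟨subset_closure hbN, ?_⟩ hbN hba.symm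
    rw [mem_preimage, mem_singleton_iff, ← h6 b (subset_closure hbN), hba,
      h3 a (subset_closure haM)]
  obtain ⟨b, ⟨hbN', hbq⟩, hbN, hab⟩ := hb
  have hbq : Y.proj b = X.proj a := hbq
  have hbF : b ∉ F := (hNV hbN').2.1
  obtain ⟨c, hc⟩ := htot b hbF (by rwa [hbq])
  have hcq : X.proj c = X.proj a := (hΓ.proj_eq c b hc).trans hbq
  have hcE : c ∉ E := fun h => haC (Or.inr ⟨c, h, hcq⟩)
  have hac : a = c := by
    refine hφ.eq_of_frequently (hMV (subset_closure haM)).2.1 hcE ?_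
    refine (hab.and_eventually (hmeet c b hc hcE hbF (by rwa [hcq]))).mono ?_
    rintro n ⟨h1, h2⟩
    rw [h1, h2]
  exact hVV' ⟨(hMV (subset_closure haM)).1, (hNV hbN').1⟩ (hac ▸ hc)

/-- Near a related pair, the limit maps coincide along the relation for all large `n`. -/
theorem eventually_iff_of_mem (hφ : IsLimitMap T X E φ) (hψ : IsLimitMap T Y F ψ)
    (hΓ : IsGluing X.toSpreadSurface Y.toSpreadSurface Γ) (hQ : Q.Finite)
    (hi : ∀ x, X.proj x ∉ Q → LocInj X.proj x)
    (hmeet : ∀ x y, (x, y) ∈ Γ → x ∉ E → y ∉ F → X.proj x ∉ Q → EventuallyMeet φ ψ x y)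
    {x : X.carrier} {y : Y.carrier} (hx : x ∉ E) (hy : y ∉ F) (hxy : (x, y) ∈ Γ) :
    ∀ᶠ p : ℕ × X.carrier × Y.carrier in atTop ×ˢ 𝓝 (x, y),
      (φ p.1 p.2.1 = ψ p.1 p.2.2 ↔ p.2 ∈ Γ) := by
  obtain ⟨B, h, hB, hxB, hc, hinj, rfl, hgr⟩ := hΓ.exists_local x y hxy
  have hnb : B ∩ h ⁻¹' Fᶜ ∩ (Eᶜ ∩ ((X.proj ⁻¹' Q)ᶜ ∪ {x})) ∈ 𝓝 x := by
    refine inter_mem (inter_mem (hB.mem_nhds hxB) ((hc.continuousAt (hB.mem_nhds hxB))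
      |>.preimage_mem_nhds (hψ.isClosed.isOpen_compl.mem_nhds hy)))
      (inter_mem (hφ.isClosed.isOpen_compl.mem_nhds hx) ?_)
    rw [union_comm]
    exact insert_mem_nhds_iff.2 ((X.isDiscrete_preimage hQ).compl_mem_nhdsNE
      (hQ.isClosed.preimage X.continuous_proj) x)
  obtain ⟨M, hM, hxM, -, hMp, hMcpt, hMV⟩ := X.locallyPlanar.exists_nhds_isPreconnected hnb
  have hMV' := subset_closure.trans hMV
  have hhc : ContinuousOn h (closure M) := hc.mono fun z hz => (hMV hz).1.1
  have hhi : InjOn h (closure M) := hinj.mono fun z hz => (hMV hz).1.1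
  have hhM : h '' M ∈ 𝓝 (h x) := X.locallyPlanar.image_mem_nhds Y.locallyPlanar
    (hM.mem_nhds hxM) (hhc.mono subset_closure) (hhi.mono subset_closure)
  have hMQ : ∀ z ∈ M \ {x}, X.proj z ∉ Q := fun z hz => (hMV' hz.1).2.2.resolve_right hz.2
  have hneb := X.locallyPlanar.nhdsNE_neBot x
  obtain ⟨a, haM, hax⟩ := Filter.nonempty_of_mem (inter_mem
    (nhdsWithin_le_nhds (hM.mem_nhds hxM)) self_mem_nhdsWithin : M ∩ {x}ᶜ ∈ 𝓝[≠] x)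
  have hgood : ∀ᶠ n in atTop, InjOn (φ n) M ∧ EqOn (fun z => ψ n (h z)) (φ n) M := by
    filter_upwards [hφ.eventually _ hMcpt fun z hz => (hMV hz).2.1,
      hψ.eventually _ (hMcpt.image_of_continuousOn hhc)
        (by rintro _ ⟨z, hz, rfl⟩; exact (hMV hz).1.2),
      hmeet a (h a) (hgr a (hMV' haM).1.1) (hMV' haM).2.1 (hMV' haM).1.2 (hMQ a ⟨haM, hax⟩)]
      with n ⟨h1, h2, h3⟩ ⟨h4, _, h6⟩ h7
    have hψc : ContinuousOn (fun z => ψ n (h z)) M :=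
      (h4.comp hhc (mapsTo_image h _)).mono subset_closure
    have hp : EqOn (fun z => ψ n (h z)) (φ n) (M \ {x}) := by
      refine eqOn_of_lifts (f := (T n).proj) hMp (hψc.mono sdiff_subset)
        (h1.mono (sdiff_subset.trans subset_closure)) ?_ ?_ (a₀ := a) ⟨haM, hax⟩ h7.symm
      · intro z hz
        rw [h6 _ (mem_image_of_mem _ (subset_closure hz.1)), h3 z (subset_closure hz.1),
          hΓ.proj_eq z (h z) (hgr z (hMV' hz.1).1.1)]
      · intro z hz
        exact (hi z (hMQ z hz)).apply_of_injOn (X := X.toSpreadSurface)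
          (Y := (T n).toSpreadSurface) (hM.mem_nhds hz.1)
          (h1.mono subset_closure) (h2.mono subset_closure) fun w hw => h3 w (subset_closure hw)
    refine ⟨h2.mono subset_closure, fun z hz => ?_⟩
    by_cases hzx : z = x
    · -- at `x` itself the two maps agree by continuity
      subst hzx
      have t1 : Tendsto (fun z => ψ n (h z)) (𝓝[≠] z) (𝓝 (ψ n (h z))) :=
        (hψc.continuousAt (hM.mem_nhds hz)).mono_left nhdsWithin_le_nhds
      have t2 : Tendsto (φ n) (𝓝[≠] z) (𝓝 (φ n z)) :=
        ((h1.mono subset_closure).continuousAt (hM.mem_nhds hz)).mono_left nhdsWithin_le_nhds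
      refine tendsto_nhds_unique t1 (t2.congr' ?_)
      filter_upwards [nhdsWithin_le_nhds (hM.mem_nhds hz), self_mem_nhdsWithin] with w hw hw'
      exact (hp ⟨hw, hw'⟩).symm
    · exact hp ⟨hz, hzx⟩
  filter_upwards [hgood.prod_mk (prod_mem_nhds (hM.mem_nhds hxM) hhM)] with p hp
  obtain ⟨⟨h1, h2⟩, h3, z, hz, hzp⟩ := hp
  have hzΓ := hgr z (hMV' hz).1.1
  have h4 : ψ p.1 p.2.2 = φ p.1 z := by rw [← hzp]; exact h2 hz
  rw [h4]
  constructor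
  · intro hp
    have h5 : p.2.1 = z := h1 h3 hz hp
    have : p.2 = (z, h z) := Prod.ext h5 hzp.symm
    rwa [this]
  · intro hp
    have h5 : (p.2.1, h z) ∈ Γ := by
      rw [hzp]
      exact hp
    rw [hΓ.left_unique _ _ _ h5 hzΓ]

/-- Near any pair of points off the exceptional sets, the limit maps coincide exactly along the
relation for all large `n`. -/
theorem eventually_meet_iff (hφ : IsLimitMap T X E φ) (hψ : IsLimitMap T Y F ψ)
    (hΓ : IsGluing X.toSpreadSurface Y.toSpreadSurface Γ) (hQ : Q.Finite)
    (hi : ∀ x, X.proj x ∉ Q → LocInj X.proj x)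
    (hmeet : ∀ x y, (x, y) ∈ Γ → x ∉ E → y ∉ F → X.proj x ∉ Q → EventuallyMeet φ ψ x y)
    (htot : ∀ y ∉ F, Y.proj y ∉ Q → ∃ x, (x, y) ∈ Γ) {x : X.carrier} {y : Y.carrier}
    (hx : x ∉ E) (hy : y ∉ F) :
    ∀ᶠ p : ℕ × X.carrier × Y.carrier in atTop ×ˢ 𝓝 (x, y),
      (φ p.1 p.2.1 = ψ p.1 p.2.2 ↔ p.2 ∈ Γ) := by
  by_cases hxy : (x, y) ∈ Γ
  · exact eventually_iff_of_mem hφ hψ hΓ hQ hi hmeet hx hy hxy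
  have hΓc : ∀ᶠ p : ℕ × X.carrier × Y.carrier in atTop ×ˢ 𝓝 (x, y), p.2 ∉ Γ :=
    tendsto_snd.eventually (hΓ.isClosed.isOpen_compl.mem_nhds hxy)
  have hne : ∀ᶠ p : ℕ × X.carrier × Y.carrier in atTop ×ˢ 𝓝 (x, y),
      φ p.1 p.2.1 ≠ ψ p.1 p.2.2 := by
    by_cases hq : X.proj x = Y.proj y
    · exact eventually_ne_of_notMem hφ hψ hΓ hQ.countable hmeet htot hx hy hxy hq
    obtain ⟨M, hM, hxM, -, -, hMc, hMV⟩ := X.locallyPlanar.exists_nhds_isPreconnected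
      (hφ.isClosed.isOpen_compl.mem_nhds hx)
    obtain ⟨N, hN, hyN, -, -, hNc, hNV⟩ := Y.locallyPlanar.exists_nhds_isPreconnected
      (hψ.isClosed.isOpen_compl.mem_nhds hy)
    have hW : ∀ᶠ p : X.carrier × Y.carrier in 𝓝 (x, y), X.proj p.1 ≠ Y.proj p.2 :=
      (isOpen_ne_fun (X.continuous_proj.comp continuous_fst)
        (Y.continuous_proj.comp continuous_snd)).mem_nhds hq
    filter_upwards [((hφ.eventually _ hMc hMV).and (hψ.eventually _ hNc hNV)).prod_mk
      (hW.and (prod_mem_nhds (hM.mem_nhds hxM) (hN.mem_nhds hyN)))] with p hp h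
    obtain ⟨⟨⟨-, -, h3⟩, -, -, h6⟩, h7, h8, h9⟩ := hp
    apply h7
    rw [← h3 _ (subset_closure h8), h, h6 _ (subset_closure h9)]
  filter_upwards [hΓc, hne] with p h1 h2
  exact iff_of_false h2 h1

end Comparison

/-! ### Gluing two surfaces -/

theorem HasLocalDegree.of_isOpenEmbedding {S S' : Type u} [TopologicalSpace S]
    [TopologicalSpace S'] {f : S → RSphere} {f' : S' → RSphere} {j : S → S'}
    (hj : IsOpenEmbedding j) (hf : ∀ x, f' (j x) = f x) {x : S} {d : ℕ}
    (h : HasLocalDegree f x d) : HasLocalDegree f' (j x) d := by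
  obtain ⟨hd, U, hxU, hU, h₁, h₂, h0, h0', hpow⟩ := h
  have himg : f' '' (j '' U) = f '' U := by
    rw [image_image]
    exact image_congr fun y _ => hf y
  let k : U ≃ₜ j '' U := hj.isEmbedding.homeomorphImage U
  have hk : ∀ (y : S) (hy : y ∈ U), k.symm ⟨j y, mem_image_of_mem j hy⟩ = ⟨y, hy⟩ := by
    intro y hy
    rw [Homeomorph.symm_apply_eq]
    rfl
  have hl : ∀ (y : S) (hy : y ∈ U) (h'), Homeomorph.setCongr himg ⟨f' (j y), h'⟩ =
      ⟨f y, mem_image_of_mem f hy⟩ := fun y hy h' => Subtype.ext (hf y)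
  refine ⟨hd, j '' U, mem_image_of_mem j hxU, hj.isOpenMap U hU, k.symm.trans h₁,
    (Homeomorph.setCongr himg).trans h₂, ?_, ?_, ?_⟩
  · rw [Homeomorph.trans_apply, hk x hxU, h0]
  · rw [Homeomorph.trans_apply, hl x hxU, h0']
  · rintro ⟨_, y, hy, rfl⟩
    rw [Homeomorph.trans_apply, Homeomorph.trans_apply, hk y hy, hl y hy]
    exact hpow ⟨y, hy⟩

namespace IsGluing

section Space

variable {X Y : SpreadSurface.{u}} {Γ : Set (X.carrier × Y.carrier)}

theorem isOpen_left (hΓ : IsGluing X Y Γ) {V : Set Y.carrier} (hV : IsOpen V) :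
    IsOpen {x | ∃ y ∈ V, (x, y) ∈ Γ} := by
  rw [isOpen_iff_mem_nhds]
  rintro x ⟨y, hy, hxy⟩
  obtain ⟨B, h, hB, hxB, hc, -, rfl, hgr⟩ := hΓ.exists_local x y hxy
  filter_upwards [hB.mem_nhds hxB,
    (hc.continuousAt (hB.mem_nhds hxB)).preimage_mem_nhds (hV.mem_nhds hy)] with b hb hbV
  exact ⟨h b, hbV, hgr b hb⟩

theorem isOpen_right (hΓ : IsGluing X Y Γ) {V : Set X.carrier} (hV : IsOpen V) :
    IsOpen {y | ∃ x ∈ V, (x, y) ∈ Γ} := by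
  rw [isOpen_iff_mem_nhds]
  rintro y ⟨x, hx, hxy⟩
  obtain ⟨B, h, hB, hxB, hc, hi, rfl, hgr⟩ := hΓ.exists_local x y hxy
  refine mem_of_superset (X.locallyPlanar.image_mem_nhds Y.locallyPlanar
    ((hB.inter hV).mem_nhds ⟨hxB, hx⟩) (hc.mono inter_subset_left) (hi.mono inter_subset_left)) ?_
  rintro _ ⟨b, hb, rfl⟩
  exact ⟨b, hb.2, hgr b hb.1⟩

/-- The equivalence relation on the disjoint union of `X` and `Y` generated by `Γ`. -/
def setoid (hΓ : IsGluing X Y Γ) : Setoid (X.carrier ⊕ Y.carrier) where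
  r
    | .inl x, .inl x' => x = x'
    | .inl x, .inr y => (x, y) ∈ Γ
    | .inr y, .inl x => (x, y) ∈ Γ
    | .inr y, .inr y' => y = y'
  iseqv := by
    refine ⟨?_, ?_, ?_⟩
    · rintro (x | y) <;> rfl
    · rintro (x | y) (x' | y') h
      · exact Eq.symm h
      · exact h
      · exact h
      · exact Eq.symm h
    · rintro (x | y) (x' | y') (x'' | y'') h h'
      · exact Eq.trans h h'
      · obtain rfl : x = x' := h
        exact h'
      · exact hΓ.left_unique _ _ _ h h'
      · obtain rfl : y' = y'' := h'
        exact h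
      · obtain rfl : x' = x'' := h'
        exact h
      · exact hΓ.right_unique _ _ _ h h'
      · obtain rfl : y = y' := h
        exact h'
      · exact Eq.trans h h'

/-- The space obtained by gluing `X` and `Y` along `Γ`. -/
abbrev Glued (hΓ : IsGluing X Y Γ) : Type u := Quotient hΓ.setoid

/-- The inclusion of `X` into the glued space. -/
def inl (hΓ : IsGluing X Y Γ) (x : X.carrier) : hΓ.Glued := Quotient.mk hΓ.setoid (.inl x)

/-- The inclusion of `Y` into the glued space. -/
def inr (hΓ : IsGluing X Y Γ) (y : Y.carrier) : hΓ.Glued := Quotient.mk hΓ.setoid (.inr y)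

theorem inl_eq_inr (hΓ : IsGluing X Y Γ) {x : X.carrier} {y : Y.carrier} :
    hΓ.inl x = hΓ.inr y ↔ (x, y) ∈ Γ := Quotient.eq (r := hΓ.setoid)

theorem injective_inl (hΓ : IsGluing X Y Γ) : Function.Injective hΓ.inl :=
  fun _ _ h => (Quotient.eq (r := hΓ.setoid)).1 h

theorem injective_inr (hΓ : IsGluing X Y Γ) : Function.Injective hΓ.inr :=
  fun _ _ h => (Quotient.eq (r := hΓ.setoid)).1 h

theorem exists_rep (hΓ : IsGluing X Y Γ) (z : hΓ.Glued) :
    (∃ x, hΓ.inl x = z) ∨ ∃ y, hΓ.inr y = z := by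
  obtain ⟨x | y, rfl⟩ := Quotient.exists_rep z
  · exact Or.inl ⟨x, rfl⟩
  · exact Or.inr ⟨y, rfl⟩

theorem isOpen_iff (hΓ : IsGluing X Y Γ) {V : Set hΓ.Glued} :
    IsOpen V ↔ IsOpen (hΓ.inl ⁻¹' V) ∧ IsOpen (hΓ.inr ⁻¹' V) :=
  isOpen_coinduced.trans isOpen_sum_iff

theorem isOpenEmbedding_inl (hΓ : IsGluing X Y Γ) : IsOpenEmbedding hΓ.inl := by
  refine IsOpenEmbedding.of_continuous_injective_isOpenMap
    (continuous_quotient_mk'.comp continuous_inl) hΓ.injective_inl fun V hV => ?_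
  rw [hΓ.isOpen_iff, preimage_image_eq _ hΓ.injective_inl]
  refine ⟨hV, ?_⟩
  convert! hΓ.isOpen_right hV using 1
  ext y
  exact exists_congr fun x => and_congr_right fun _ => hΓ.inl_eq_inr

theorem isOpenEmbedding_inr (hΓ : IsGluing X Y Γ) : IsOpenEmbedding hΓ.inr := by
  refine IsOpenEmbedding.of_continuous_injective_isOpenMap
    (continuous_quotient_mk'.comp continuous_inr) hΓ.injective_inr fun V hV => ?_
  rw [hΓ.isOpen_iff, preimage_image_eq _ hΓ.injective_inr]
  refine ⟨?_, hV⟩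
  convert! hΓ.isOpen_left hV using 1
  ext x
  exact exists_congr fun y => and_congr_right fun _ => eq_comm.trans hΓ.inl_eq_inr

theorem isOpenMap_mk (hΓ : IsGluing X Y Γ) : IsOpenMap (Quotient.mk hΓ.setoid) :=
  isOpenMap_sum.2 ⟨hΓ.isOpenEmbedding_inl.isOpenMap, hΓ.isOpenEmbedding_inr.isOpenMap⟩

theorem t2Space (hΓ : IsGluing X Y Γ) : T2Space hΓ.Glued := by
  have key : ∀ x y, hΓ.inl x ≠ hΓ.inr y → ∃ V W, IsOpen V ∧ IsOpen W ∧ hΓ.inl x ∈ V ∧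
      hΓ.inr y ∈ W ∧ Disjoint V W := by
    intro x y hne
    obtain ⟨V, W, hV, hW, hx, hy, hVW⟩ := isOpen_prod_iff.1 hΓ.isClosed.isOpen_compl x y
      fun h => hne (hΓ.inl_eq_inr.2 h)
    refine ⟨_, _, hΓ.isOpenEmbedding_inl.isOpenMap V hV, hΓ.isOpenEmbedding_inr.isOpenMap W hW,
      mem_image_of_mem _ hx, mem_image_of_mem _ hy, disjoint_left.2 ?_⟩
    rintro _ ⟨a, ha, rfl⟩ ⟨b, hb, hab⟩
    exact hVW ⟨ha, hb⟩ (hΓ.inl_eq_inr.1 hab.symm)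
  have key' : ∀ {S : Type u} [TopologicalSpace S] [T2Space S] {j : S → hΓ.Glued},
      IsOpenEmbedding j → ∀ x x', j x ≠ j x' → ∃ V W, IsOpen V ∧ IsOpen W ∧ j x ∈ V ∧
      j x' ∈ W ∧ Disjoint V W := by
    intro S _ _ j hj x x' hne
    obtain ⟨V, W, hV, hW, hx, hx', hVW⟩ := t2_separation fun h => hne (congrArg j h)
    exact ⟨_, _, hj.isOpenMap V hV, hj.isOpenMap W hW, mem_image_of_mem _ hx,
      mem_image_of_mem _ hx', (disjoint_image_iff hj.injective).2 hVW⟩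
  refine ⟨fun z z' hne => ?_⟩
  rcases hΓ.exists_rep z with ⟨x, rfl⟩ | ⟨y, rfl⟩ <;>
    rcases hΓ.exists_rep z' with ⟨x', rfl⟩ | ⟨y', rfl⟩
  · exact key' hΓ.isOpenEmbedding_inl _ _ hne
  · exact key _ _ hne
  · obtain ⟨V, W, hV, hW, h1, h2, h3⟩ := key _ _ hne.symm
    exact ⟨W, V, hW, hV, h2, h1, h3.symm⟩
  · exact key' hΓ.isOpenEmbedding_inr _ _ hne

/-- The projection of the glued space to the sphere. -/
def proj (hΓ : IsGluing X Y Γ) : hΓ.Glued → RSphere :=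
  Quotient.lift (Sum.elim X.proj Y.proj) <| by
    rintro (x | y) (x' | y') h
    · exact congrArg X.proj h
    · exact hΓ.proj_eq _ _ h
    · exact (hΓ.proj_eq _ _ h).symm
    · exact congrArg Y.proj h

end Space

variable {X Y : PointedSurface.{u}} {Γ : Set (X.carrier × Y.carrier)}

/-- A set without accumulation points in each of two open pieces has none in their union. -/
theorem isDiscrete_of_preimages (hΓ : IsGluing X.toSpreadSurface Y.toSpreadSurface Γ)
    {A : Set hΓ.Glued} (hl : IsDiscrete (hΓ.inl ⁻¹' A)) (hr : IsDiscrete (hΓ.inr ⁻¹' A)) :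
    IsDiscrete A := by
  have key : ∀ {S : Type u} [TopologicalSpace S] {j : S → hΓ.Glued}, IsOpenEmbedding j →
      IsDiscrete (j ⁻¹' A) → ∀ x, j x ∈ A → ∃ V, IsOpen V ∧ V ∩ A = {j x} := by
    intro S _ j hj hd x hx
    obtain ⟨V, hV, hVA⟩ := isDiscrete_iff_forall_mem_exists_isOpen.1 hd x hx
    refine ⟨j '' V, hj.isOpenMap V hV, ?_⟩
    rw [← image_inter_preimage, hVA, image_singleton]
  rw [isDiscrete_iff_forall_mem_exists_isOpen]
  intro z hz
  rcases hΓ.exists_rep z with ⟨x, rfl⟩ | ⟨y, rfl⟩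
  · exact key hΓ.isOpenEmbedding_inl hl x hz
  · exact key hΓ.isOpenEmbedding_inr hr y hz

/-- The pointed surface obtained by gluing two pointed surfaces along a relation between their
marked points. -/
def glue (hΓ : IsGluing X.toSpreadSurface Y.toSpreadSurface Γ) (hpt : (X.pt, Y.pt) ∈ Γ) :
    PointedSurface.{u} where
  carrier := hΓ.Glued
  t2 := hΓ.t2Space
  secondCountable := TopologicalSpace.Quotient.secondCountableTopology hΓ.isOpenMap_mk
  connected := by
    have h : range hΓ.inl ∪ range hΓ.inr = univ := by
      rw [eq_univ_iff_forall]
      exact hΓ.exists_rep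
    have : IsConnected (univ : Set hΓ.Glued) := by
      rw [← h]
      exact (isConnected_range hΓ.isOpenEmbedding_inl.continuous).union
        ⟨hΓ.inl X.pt, mem_range_self _, hΓ.inl_eq_inr.2 hpt ▸ mem_range_self _⟩
        (isConnected_range hΓ.isOpenEmbedding_inr.continuous)
    exact connectedSpace_iff_univ.2 this
  chart_at := by
    have key : ∀ {S : Type u} [TopologicalSpace S] {j : S → hΓ.Glued}, IsOpenEmbedding j →
        ∀ x, (∃ e : OpenPartialHomeomorph S ℂ, x ∈ e.source) →
        ∃ e : OpenPartialHomeomorph hΓ.Glued ℂ, j x ∈ e.source := by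
      rintro S _ j hj x ⟨e, he⟩
      have : Nonempty S := ⟨x⟩
      refine ⟨(hj.toOpenPartialHomeomorph j).symm.trans e, ?_⟩
      rw [OpenPartialHomeomorph.trans_source]
      refine ⟨⟨x, mem_univ x, rfl⟩, ?_⟩
      rwa [mem_preimage, hj.toOpenPartialHomeomorph_left_inv]
    intro z
    rcases hΓ.exists_rep z with ⟨x, rfl⟩ | ⟨y, rfl⟩
    · exact key hΓ.isOpenEmbedding_inl x (X.chart_at x)
    · exact key hΓ.isOpenEmbedding_inr y (Y.chart_at y)
  proj := hΓ.proj
  continuous_proj :=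
    (X.continuous_proj.sumElim Y.continuous_proj).quotient_lift _
  isOpenMap_proj := by
    intro V hV
    have h : hΓ.proj '' V = X.proj '' (hΓ.inl ⁻¹' V) ∪ Y.proj '' (hΓ.inr ⁻¹' V) := by
      ext q
      constructor
      · rintro ⟨z, hz, rfl⟩
        rcases hΓ.exists_rep z with ⟨x, rfl⟩ | ⟨y, rfl⟩
        · exact Or.inl ⟨x, hz, rfl⟩
        · exact Or.inr ⟨y, hz, rfl⟩
      · rintro (⟨x, hx, rfl⟩ | ⟨y, hy, rfl⟩)
        · exact ⟨hΓ.inl x, hx, rfl⟩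
        · exact ⟨hΓ.inr y, hy, rfl⟩
    rw [h]
    exact (X.isOpenMap_proj _ (hΓ.isOpen_iff.1 hV).1).union
      (Y.isOpenMap_proj _ (hΓ.isOpen_iff.1 hV).2)
  discrete_proj q := hΓ.isDiscrete_of_preimages (X.discrete_proj q) (Y.discrete_proj q)
  pt := hΓ.inl X.pt
  not_critical := fun h => h (HasLocalDegree.of_isOpenEmbedding hΓ.isOpenEmbedding_inl
    (fun _ => rfl) (not_not.1 X.not_critical))

theorem sub_glue_left (hΓ : IsGluing X.toSpreadSurface Y.toSpreadSurface Γ)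
    (hpt : (X.pt, Y.pt) ∈ Γ) : X.Sub (hΓ.glue hpt) :=
  ⟨hΓ.inl, hΓ.isOpenEmbedding_inl.continuous, hΓ.injective_inl, rfl, fun _ => rfl⟩

theorem sub_glue_right (hΓ : IsGluing X.toSpreadSurface Y.toSpreadSurface Γ)
    (hpt : (X.pt, Y.pt) ∈ Γ) : Y.Sub (hΓ.glue hpt) :=
  ⟨hΓ.inr, hΓ.isOpenEmbedding_inr.continuous, hΓ.injective_inr, (hΓ.inl_eq_inr.2 hpt).symm,
    fun _ => rfl⟩

/-- The compact subsets of the glued surface embed into the sequence as soon as the limit maps of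
the two pieces coincide exactly along the gluing relation. -/
theorem compactsEmbed_glue {T : ℕ → PointedSurface.{u}} {E : Set X.carrier} {F : Set Y.carrier}
    {φ : ∀ n, X.carrier → (T n).carrier} {ψ : ∀ n, Y.carrier → (T n).carrier}
    (hΓ : IsGluing X.toSpreadSurface Y.toSpreadSurface Γ) (hpt : (X.pt, Y.pt) ∈ Γ)
    (hφ : IsLimitMap T X E φ) (hψ : IsLimitMap T Y F ψ)
    (h : ∀ x ∉ E, ∀ y ∉ F, ∀ᶠ p : ℕ × X.carrier × Y.carrier in atTop ×ˢ 𝓝 (x, y),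
      (φ p.1 p.2.1 = ψ p.1 p.2.2 ↔ p.2 ∈ Γ)) :
    CompactsEmbed T (hΓ.glue hpt) := by
  have := hΓ.t2Space
  have hl := hΓ.isOpenEmbedding_inl
  have hr := hΓ.isOpenEmbedding_inr
  have hUl : IsOpen (hΓ.inl '' Eᶜ) := hl.isOpenMap _ hφ.isClosed.isOpen_compl
  have hUr : IsOpen (hΓ.inr '' Fᶜ) := hr.isOpenMap _ hψ.isClosed.isOpen_compl
  refine ⟨(hΓ.inl '' Eᶜ ∪ hΓ.inr '' Fᶜ)ᶜ, (hUl.union hUr).isClosed_compl, ?_, ?_, ?_⟩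
  · refine hΓ.isDiscrete_of_preimages (hφ.isDiscrete.mono fun x hx => ?_)
      (hψ.isDiscrete.mono fun y hy => ?_)
    · by_contra hxE
      exact hx (Or.inl (mem_image_of_mem _ hxE))
    · by_contra hyF
      exact hy (Or.inr (mem_image_of_mem _ hyF))
  · exact fun hp => hp (Or.inl (mem_image_of_mem _ hφ.pt_notMem))
  intro (K : Set hΓ.Glued) (hK : IsCompact K) hKE hptK
  rw [compl_compl] at hKE
  obtain ⟨K₁, K₂, hK₁, hK₂, hK₁U, hK₂U, rfl⟩ := IsCompact.binary_compact_cover (X := hΓ.Glued)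
    hK hUl hUr hKE
  have hA : ∀ {S : Type u} [TopologicalSpace S] {j : S → hΓ.Glued} {L : Set hΓ.Glued}
      {G : Set S}, IsOpenEmbedding j → IsCompact L → L ⊆ j '' Gᶜ →
      IsCompact (j ⁻¹' L) ∧ j ⁻¹' L ⊆ Gᶜ := by
    intro S _ j L G hj hL hLG
    refine ⟨hj.isInducing.isCompact_preimage' hL (hLG.trans (image_subset_range _ _)), ?_⟩
    intro x hx
    obtain ⟨y, hy, hyx⟩ := hLG hx
    rwa [← hj.injective hyx]
  obtain ⟨hA₁, hA₁E⟩ := hA hl hK₁ hK₁U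
  obtain ⟨hA₂, hA₂F⟩ := hA hr hK₂ hK₂U
  have hiff : ∀ᶠ n in atTop, ∀ x ∈ hΓ.inl ⁻¹' K₁, ∀ y ∈ hΓ.inr ⁻¹' K₂,
      (φ n x = ψ n y ↔ (x, y) ∈ Γ) := by
    have h1 := (hA₁.prod hA₂).mem_prod_nhdsSet_of_forall (l := atTop)
      (s := {p : ℕ × X.carrier × Y.carrier | φ p.1 p.2.1 = ψ p.1 p.2.2 ↔ p.2 ∈ Γ})
      fun p hp => h p.1 (hA₁E hp.1) p.2 (hA₂F hp.2)
    have h2 : ∀ᶠ p : ℕ × X.carrier × Y.carrier in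
        atTop ×ˢ 𝓝ˢ ((hΓ.inl ⁻¹' K₁) ×ˢ (hΓ.inr ⁻¹' K₂)),
        (φ p.1 p.2.1 = ψ p.1 p.2.2 ↔ p.2 ∈ Γ) := h1
    filter_upwards [h2.curry] with n hn x hx y hy
    exact hn.self_of_nhdsSet (x, y) ⟨hx, hy⟩
  obtain ⟨N, hN⟩ := eventually_atTop.1 (hiff.and ((hφ.eventually _ hA₁ hA₁E).and
    ((hψ.eventually _ hA₂ hA₂F).and (hφ.eventually_pt.and hψ.eventually_pt))))
  refine ⟨N, fun n hn => ?_⟩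
  obtain ⟨hiff, ⟨hc₁, hi₁, hl₁⟩, ⟨hc₂, hi₂, hl₂⟩, hp₁, hp₂⟩ := hN n (le_of_lt hn)
  -- the embedding of `K₁ ∪ K₂` is `φ n` on `K₁` and `ψ n` on `K₂`
  have hex : ∀ z : hΓ.Glued, ∃ w : (T n).carrier,
      (∀ x, hΓ.inl x = z → z ∈ K₁ → w = φ n x) ∧ ∀ y, hΓ.inr y = z → z ∈ K₂ → w = ψ n y := by
    intro z
    by_cases h1 : ∃ x, hΓ.inl x = z ∧ z ∈ K₁
    · obtain ⟨x, rfl, hx⟩ := h1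
      refine ⟨φ n x, fun x' hx' _ => by rw [hΓ.injective_inl hx'], fun y hy hyK => ?_⟩
      refine (hiff x hx y (by rwa [mem_preimage, hy])).2 (hΓ.inl_eq_inr.1 hy.symm)
    · by_cases h2 : ∃ y, hΓ.inr y = z
      · obtain ⟨y, rfl⟩ := h2
        exact ⟨ψ n y, fun x hx hxK => absurd ⟨x, hx, hxK⟩ h1,
          fun y' hy' _ => by rw [hΓ.injective_inr hy']⟩
      · exact ⟨(T n).pt, fun x hx hxK => absurd ⟨x, hx, hxK⟩ h1, fun y hy _ => absurd ⟨y, hy⟩ h2⟩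
  choose Φ hΦ₁ hΦ₂ using hex
  replace hΦ₁ : ∀ x, hΓ.inl x ∈ K₁ → Φ (hΓ.inl x) = φ n x := fun x hx => hΦ₁ _ x rfl hx
  replace hΦ₂ : ∀ y, hΓ.inr y ∈ K₂ → Φ (hΓ.inr y) = ψ n y := fun y hy => hΦ₂ _ y rfl hy
  have hrep : ∀ z ∈ K₁ ∪ K₂, (∃ x, hΓ.inl x ∈ K₁ ∧ hΓ.inl x = z) ∨
      ∃ y, hΓ.inr y ∈ K₂ ∧ hΓ.inr y = z := by
    rintro z (hz | hz)
    · obtain ⟨x, -, rfl⟩ := hK₁U hz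
      exact Or.inl ⟨x, hz, rfl⟩
    · obtain ⟨y, -, rfl⟩ := hK₂U hz
      exact Or.inr ⟨y, hz, rfl⟩
  have hcont : ∀ {S : Type u} [TopologicalSpace S] {j : S → hΓ.Glued} {L : Set hΓ.Glued}
      {G : Set S} {χ : S → (T n).carrier}, IsOpenEmbedding j → L ⊆ j '' Gᶜ →
      ContinuousOn χ (j ⁻¹' L) → (∀ x, j x ∈ L → Φ (j x) = χ x) → ContinuousOn Φ L := by
    intro S _ j L G χ hj hLG hχ hΦ
    have hL : j '' (j ⁻¹' L) = L :=
      image_preimage_eq_of_subset (hLG.trans (image_subset_range _ _))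
    rw [← hL]
    rintro _ ⟨x, hx, rfl⟩
    rw [ContinuousWithinAt, ← hj.isInducing.map_nhdsWithin_eq, tendsto_map'_iff]
    exact (hχ.congr fun y hy => hΦ y hy) x hx
  have hΦc : ContinuousOn Φ (K₁ ∪ K₂) :=
    (hcont hl hK₁U hc₁ hΦ₁).union_of_isClosed (hcont hr hK₂U hc₂ hΦ₂) hK₁.isClosed hK₂.isClosed
  have hΦi : InjOn Φ (K₁ ∪ K₂) := by
    intro z hz z' hz' hzz'
    rcases hrep z hz with ⟨x, hx, rfl⟩ | ⟨y, hy, rfl⟩ <;>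
      rcases hrep z' hz' with ⟨x', hx', rfl⟩ | ⟨y', hy', rfl⟩
    · rw [hΦ₁ x hx, hΦ₁ x' hx'] at hzz'
      rw [hi₁ hx hx' hzz']
    · rw [hΦ₁ x hx, hΦ₂ y' hy'] at hzz'
      exact hΓ.inl_eq_inr.2 ((hiff x hx y' hy').1 hzz')
    · rw [hΦ₂ y hy, hΦ₁ x' hx'] at hzz'
      exact (hΓ.inl_eq_inr.2 ((hiff x' hx' y hy).1 hzz'.symm)).symm
    · rw [hΦ₂ y hy, hΦ₂ y' hy'] at hzz'
      rw [hi₂ hy hy' hzz']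
  have : CompactSpace ↥(K₁ ∪ K₂) := isCompact_iff_compactSpace.1 hK
  refine ⟨fun z => Φ z.1, ?_, ?_, ?_⟩
  · exact ((continuousOn_iff_continuous_domRestrict.1 hΦc).isClosedEmbedding
      (injOn_iff_injective.1 hΦi)).isEmbedding
  · rcases hptK with hp | hp
    · exact (hΦ₁ X.pt hp).trans hp₁
    · change Φ (hΓ.inl X.pt) = _
      have he : hΓ.inl X.pt = hΓ.inr Y.pt := hΓ.inl_eq_inr.2 hpt
      have hp' : hΓ.inl X.pt ∈ K₂ := hp
      rw [he] at hp' ⊢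
      exact (hΦ₂ Y.pt hp').trans hp₂
  · rintro ⟨z, hz⟩
    rcases hrep z hz with ⟨x, hx, rfl⟩ | ⟨y, hy, rfl⟩
    · change (T n).proj (Φ (hΓ.inl x)) = X.proj x
      rw [hΦ₁ x hx, hl₁ x hx]
    · change (T n).proj (Φ (hΓ.inr y)) = Y.proj y
      rw [hΦ₂ y hy, hl₂ y hy]

end IsGluing

/-! ### Uniqueness of the kernel -/

namespace PointedSurface

theorem Sub.trans_equivalent_symm {X Y Z : PointedSurface.{u}} (h : Y.Sub Z) (h' : X.Equivalent Z) :
    Y.Sub X := by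
  obtain ⟨φ, hc, hi, hpt, hf⟩ := h
  obtain ⟨e, hept, he⟩ := h'
  refine ⟨fun y => e.symm (φ y), e.symm.continuous.comp hc, e.symm.injective.comp hi, ?_, ?_⟩
  · change e.symm (φ Y.pt) = X.pt
    rw [hpt, ← hept, e.symm_apply_apply]
  · intro y
    rw [he, e.apply_symm_apply, hf]

theorem Equivalent.symm {X Y : PointedSurface.{u}} (h : X.Equivalent Y) : Y.Equivalent X := by
  obtain ⟨e, hept, he⟩ := h
  refine ⟨e.symm, by rw [← hept, e.symm_apply_apply], fun y => ?_⟩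
  rw [he, e.apply_symm_apply]

theorem Equivalent.trans {X Y Z : PointedSurface.{u}} (h : X.Equivalent Y) (h' : Y.Equivalent Z) :
    X.Equivalent Z := by
  obtain ⟨e, hept, he⟩ := h
  obtain ⟨e', hept', he'⟩ := h'
  exact ⟨e.trans e', by rw [Homeomorph.trans_apply, hept, hept'], fun x => by
    rw [he, he', Homeomorph.trans_apply]⟩

end PointedSurface

/-- A kernel of the Speiser class is the greatest pointed surface whose compact subsets embed into
the sequence. -/
theorem IsKernel.sub_of_compactsEmbed {T : ℕ → PointedSurface.{u}} (hT : HasCommonDisk T)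
    {X : PointedSurface.{u}} (hX : IsKernel T X) (hXS : X.toSpreadSurface.IsSpeiser)
    {Y : PointedSurface.{u}} (hY : CompactsEmbed T Y) : Y.Sub X := by
  obtain ⟨E, φ, hφ⟩ := hX.1.exists_isLimitMap
  obtain ⟨F, ψ, hψ⟩ := hY.exists_isLimitMap
  obtain ⟨g, hgc, hgi, hg, hmeet, hpt⟩ := exists_matching hT hXS hφ hψ
  have hQ : IsClosed X.singularValues := Set.Finite.isClosed hXS
  have hF : IsClosed (F ∪ Y.proj ⁻¹' X.singularValues) :=
    hψ.isClosed.union (hQ.preimage Y.continuous_proj)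
  have hFd : IsDiscrete (F ∪ Y.proj ⁻¹' X.singularValues) := isDiscrete_union hψ.isClosed
    (hQ.preimage Y.continuous_proj) hψ.isDiscrete (Y.isDiscrete_preimage hXS)
  have hΓ : IsGluing X.toSpreadSurface Y.toSpreadSurface _ :=
    isGluing_closureGraph hF hFd hgc hgi hg
  have hglue : CompactsEmbed T (hΓ.glue hpt) := by
    refine hΓ.compactsEmbed_glue hpt hφ hψ fun x hx y hy => eventually_meet_iff hφ hψ hΓ hXS
      (fun x hx => X.locInj_of_notMem_singularValues hx) ?_ ?_ hx hy
    · intro x y hxy hxE hyF hxQ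
      have hyF' : y ∉ F ∪ Y.proj ⁻¹' X.singularValues := by
        rintro (h | h)
        · exact hyF h
        · rw [mem_preimage, ← hΓ.proj_eq x y hxy] at h
          exact hxQ h
      obtain rfl := eq_of_mem_closureGraph hF hgc hyF' hxy
      exact hmeet y hyF' hxE
    · exact fun y hyF hyQ => ⟨g y, mem_closureGraph fun h => h.elim hyF hyQ⟩
  exact (hΓ.sub_glue_right hpt).trans_equivalent_symm (hX.2 _ hglue (hΓ.sub_glue_left hpt))

end

theorem proposition2p2 (T : ℕ → PointedSurface.{u}) (hT : HasCommonDisk T)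
    (X : PointedSurface.{u}) (hX : IsKernel T X) (hXS : X.toSpreadSurface.IsSpeiser)
    (Y Z : PointedSurface.{u}) (hY : IsKernel T Y) (hZ : IsKernel T Z) :
    Y.Equivalent Z := by
  have key : ∀ W : PointedSurface.{u}, IsKernel T W → W.Equivalent X := fun W hW =>
    hW.2 X hX.1 (hX.sub_of_compactsEmbed hT hXS hW.1)
  exact (key Y hY).trans (key Z hZ).symm
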